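/- Let $\mathrm{k}=\mathbb R$ or $\mathbb C$, let $G$ be a (finite-dimensional) Lie group over $\mathrm{k}$ with Lie algebra $\mathfrak g=\mathrm{Lie}\,G$, and let $r\in\mathfrak g\wedge\mathfrak g\subset\mathfrak g\otimes\mathfrak g$ be a nondegenerate skew-symmetric solution of the classical Yang--Baxter equation $$[r_{12},r_{13}]+[r_{12},r_{23}]+[r_{13},r_{23}]=0,$$ where nondegenerate means that $(\xi,\eta)\mapsto(\xi\otimes\eta)(r)$ is a nondegenerate form on $\mathfrak g^*$. Let $\check r\colon\mathfrak g^*\to\mathfrak g$, $\check r(\xi)=(\xi\otimes\mathrm{Id})(r)$, which is then an isomorphism, and let $\mathcal L_r$ be the left invariant bivector field on $G$ with value $r$ at the identity $e$ (a left invariant symplectic structure). Smooth means $C^\infty$ if $\mathrm{k}=\mathbb R$ and holomorphic if $\mathrm{k}=\mathbb C$. The action of $G$ on itself by left translations is called weakly Hamiltonian on $(G,\mathcal L_r)$ if it has a moment map, i.e. a smooth map $J\colon G\to\mathfrak g^*$ such that for all $x\in\mathfrak g$ the Hamiltonian vector field $X_{J^*(x)}=d(J^*(x))\rfloor\mathcal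 L_r$ of the function $J^*(x)=\langle J(\cdot),x\rangle$ equals the vector field $x_G$ induced by $x$, $x_G(g)=\frac{d}{dt}\big|_{t=0}\exp(tx)g$. A group 1-cocycle $\mathcal B\colon G\to\mathfrak g^*$ is a smooth map with $\mathcal B(gh)=\mathcal B(g)+\mathrm{Ad}^*_g\mathcal B(h)$ for all $g,h\in G$, where $\langle\mathrm{Ad}^*_g\xi,x\rangle=\langle\xi,\mathrm{Ad}_{g^{-1}}x\rangle$. Consider the conditions: 1. The left action of $G$ on $(G,\mathcal L_r)$ is weakly Hamiltonian. 2. There exists a group 1-cocycle $\mathcal B\colon G\to\mathfrak g^*$ with $d_e\mathcal B=\check r^{-1}$. Then (2) implies (1), and if $G$ is connected, then (1) and (2) are equivalent. Moreover, both (1) and (2) hold if $G$ is simply connected (in particular connected), and also if $\check r^{-1}\colon\mathfrak g\to\mathfrak g^*$ is a coboundary, i.e. if there is $\xi\in\mathfrak g^*$ with $\langle\check r^{-1}(x),y\rangle=-\langle\xi,[x,y]\rangle$ for all $x,y\in\mathfrak g$. -/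

import Mathlib

open scoped Manifold ContDiff TensorProduct

noncomputable section

namespace TriangularPoisson

/-! ### Linear algebra of `2`-tensors -/

section Tensors

variable {k L : Type*} [Field k] [AddCommGroup L] [Module k L]

/-- The contraction `(ξ ⊗ Id) r` of a tensor `r ∈ L ⊗ L` with a covector in the first slot. -/
def contract (ξ : Module.Dual k L) (r : L ⊗[k] L) : L :=
  TensorProduct.lid k L (LinearMap.rTensor L ξ r)

/-- The map `ř : L* → L`, `ř(ξ) = (ξ ⊗ Id) r`. -/
def rCheck (r : L ⊗[k] L) : Module.Dual k L →ₗ[k] L where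
  toFun ξ := contract ξ r
  map_add' ξ η := by simp [contract, LinearMap.rTensor_add]
  map_smul' c ξ := by simp [contract, LinearMap.rTensor_smul]

/-- `r` is skew, i.e. it lies in the subspace `L ∧ L` of `L ⊗ L`. -/
def IsSkew (r : L ⊗[k] L) : Prop :=
  TensorProduct.comm k L L r = -r

/-- The bilinear form `(ξ, η) ↦ (ξ ⊗ η)(r)` on `L*` given by `r ∈ L ⊗ L`. -/
def dualForm (r : L ⊗[k] L) : LinearMap.BilinForm k (Module.Dual k L) :=
  LinearMap.mk₂ k (fun ξ η => TensorProduct.dualDistrib k L L (ξ ⊗ₜ[k] η) r)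
    (by intros; simp [TensorProduct.add_tmul]) (by intros; rw [← TensorProduct.smul_tmul', map_smul]; rfl)
    (by intros; simp [TensorProduct.tmul_add]) (by intros; simp [TensorProduct.tmul_smul])

/-- `r` is nondegenerate: it defines a nondegenerate bilinear form on `L*`. -/
def IsNondegenerate (r : L ⊗[k] L) : Prop :=
  (dualForm r).Nondegenerate

lemma dualForm_apply (r : L ⊗[k] L) (ξ η : Module.Dual k L) :
    dualForm r ξ η = η (rCheck r ξ) := by
  change TensorProduct.dualDistrib k L L (ξ ⊗ₜ[k] η) r = η (contract ξ r)
  induction r using TensorProduct.induction_on with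
  | zero => simp [contract]
  | tmul a b => simp [contract]
  | add a b ha hb =>
    have h : contract ξ (a + b) = contract ξ a + contract ξ b := by simp [contract]
    rw [map_add, ha, hb, h, map_add]

lemma rCheck_bijective [FiniteDimensional k L] {r : L ⊗[k] L} (h : IsNondegenerate r) :
    Function.Bijective (rCheck r) := by
  have hinj : Function.Injective (rCheck r) := by
    rw [injective_iff_map_eq_zero]
    intro ξ hξ
    refine h.1 ξ fun η => ?_
    rw [dualForm_apply, hξ, map_zero]
  refine ⟨hinj, ?_⟩
  exact (LinearMap.injective_iff_surjective_of_finrank_eq_finrank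
    (Subspace.dual_finrank_eq (K := k) (V := L))).1 hinj

/-- The inverse `ř⁻¹ : L → L*` for a nondegenerate `r`. -/
def rCheckInv [FiniteDimensional k L] (r : L ⊗[k] L) (h : IsNondegenerate r) :
    L →ₗ[k] Module.Dual k L :=
  (LinearEquiv.ofBijective (rCheck r) (rCheck_bijective h)).symm.toLinearMap

end Tensors

section YangBaxter

variable {k L : Type*} [Field k] [LieRing L] [LieAlgebra k L]

/-- The bracket `L ⊗ L → L`, `a ⊗ b ↦ [a, b]`. -/
def bracketMap (k L : Type*) [Field k] [LieRing L] [LieAlgebra k L] : L ⊗[k] L →ₗ[k] L :=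
  (LieModule.toModuleHom k L L : L ⊗[k] L →ₗ[k] L)

/-- `(a ⊗ b) ⊗ (c ⊗ d) ↦ [a, c] ⊗ b ⊗ d`; it sends `r ⊗ r` to `[r₁₂, r₁₃]`. -/
def bracket1213 (k L : Type*) [Field k] [LieRing L] [LieAlgebra k L] :
    (L ⊗[k] L) ⊗[k] (L ⊗[k] L) →ₗ[k] L ⊗[k] (L ⊗[k] L) :=
  (LinearMap.rTensor (L ⊗[k] L) (bracketMap k L)) ∘ₗ
    (TensorProduct.tensorTensorTensorComm k L L L L).toLinearMap

/-- `(a ⊗ b) ⊗ (c ⊗ d) ↦ a ⊗ [b, c] ⊗ d`; it sends `r ⊗ r` to `[r₁₂, r₂₃]`. -/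
def bracket1223 (k L : Type*) [Field k] [LieRing L] [LieAlgebra k L] :
    (L ⊗[k] L) ⊗[k] (L ⊗[k] L) →ₗ[k] L ⊗[k] (L ⊗[k] L) :=
  (LinearMap.lTensor L ((LinearMap.rTensor L (bracketMap k L)) ∘ₗ
      (TensorProduct.assoc k L L L).symm.toLinearMap)) ∘ₗ
    (TensorProduct.assoc k L L (L ⊗[k] L)).toLinearMap

/-- `(a ⊗ b) ⊗ (c ⊗ d) ↦ a ⊗ c ⊗ [b, d]`; it sends `r ⊗ r` to `[r₁₃, r₂₃]`. -/
def bracket1323 (k L : Type*) [Field k] [LieRing L] [LieAlgebra k L] :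
    (L ⊗[k] L) ⊗[k] (L ⊗[k] L) →ₗ[k] L ⊗[k] (L ⊗[k] L) :=
  (TensorProduct.assoc k L L L).toLinearMap ∘ₗ
    (LinearMap.lTensor (L ⊗[k] L) (bracketMap k L)) ∘ₗ
    (TensorProduct.tensorTensorTensorComm k L L L L).toLinearMap

/-- The left-hand side `[r₁₂, r₁₃] + [r₁₂, r₂₃] + [r₁₃, r₂₃] ∈ L ⊗ L ⊗ L` of the classical
Yang-Baxter equation. -/
def yangBaxter (r : L ⊗[k] L) : L ⊗[k] (L ⊗[k] L) :=
  bracket1213 k L (r ⊗ₜ[k] r) + bracket1223 k L (r ⊗ₜ[k] r) + bracket1323 k L (r ⊗ₜ[k] r)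

end YangBaxter

/-! ### Hamiltonian vector fields and moment maps

All manifolds are modelled on normed spaces over `𝕜`, without boundary. For `𝕜 = ℂ`, smooth
means holomorphic. -/

section Manifolds

variable {𝕜 : Type*} [RCLike 𝕜]
  {E : Type*} [NormedAddCommGroup E] [NormedSpace 𝕜 E]
  {F : Type*} [NormedAddCommGroup F] [NormedSpace 𝕜 F]

/-- The differential at `m` of a scalar function, as a covector at `m`. -/
def differential {M : Type*} [TopologicalSpace M] [ChartedSpace F M] (f : M → 𝕜) (m : M) :
    Module.Dual 𝕜 (TangentSpace 𝓘(𝕜, F) m) :=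
  ((NormedSpace.fromTangentSpace (f m)).toContinuousLinearMap.comp
    (mfderiv 𝓘(𝕜, F) 𝓘(𝕜, 𝕜) f m)).toLinearMap

/-- The Hamiltonian vector field `X_f = df ⌟ π` of a function with respect to a bivector
field `π`. -/
def hamiltonianVectorField {M : Type*} [TopologicalSpace M] [ChartedSpace F M]
    (π : ∀ m : M, TangentSpace 𝓘(𝕜, F) m ⊗[𝕜] TangentSpace 𝓘(𝕜, F) m) (f : M → 𝕜) (m : M) :
    TangentSpace 𝓘(𝕜, F) m :=
  contract (differential (F := F) f m) (π m)

variable {G : Type*} [TopologicalSpace G] [ChartedSpace E G] [Group G]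

/-- The vector field `x_M` on `M` induced by an element `x` of the Lie algebra through an action
of `G` on `M`: its value at `m` is the derivative at the identity, in the direction `x`, of the
orbit map `g ↦ g • m`. -/
def inducedVectorField {M : Type*} [TopologicalSpace M] [ChartedSpace F M] [MulAction G M]
    (x : GroupLieAlgebra 𝓘(𝕜, E) G) (m : M) : TangentSpace 𝓘(𝕜, F) m :=
  mfderiv 𝓘(𝕜, E) 𝓘(𝕜, F) (fun g : G => g • m) 1 x

/-- A map into the dual of the Lie algebra is smooth if all its coordinates are (the Lie algebra
is finite-dimensional wherever this is used). -/
def IsSmoothToDual {M : Type*} [TopologicalSpace M] [ChartedSpace F M]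
    (J : M → Module.Dual 𝕜 (GroupLieAlgebra 𝓘(𝕜, E) G)) : Prop :=
  ∀ x, ContMDiff 𝓘(𝕜, F) 𝓘(𝕜, 𝕜) ∞ (fun m => J m x)

/-- A moment map `J : M → 𝔤*` for an action of `G` on `(M, π)`: a smooth map such that, for every
`x ∈ 𝔤`, the Hamiltonian vector field of `J*(x) = ⟨J(·), x⟩` is `x_M`. -/
def IsMomentMap {M : Type*} [TopologicalSpace M] [ChartedSpace F M] [MulAction G M]
    (π : ∀ m : M, TangentSpace 𝓘(𝕜, F) m ⊗[𝕜] TangentSpace 𝓘(𝕜, F) m)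
    (J : M → Module.Dual 𝕜 (GroupLieAlgebra 𝓘(𝕜, E) G)) : Prop :=
  IsSmoothToDual (F := F) J ∧
    ∀ (x : GroupLieAlgebra 𝓘(𝕜, E) G) (m : M),
      hamiltonianVectorField π (fun m' => J m' x) m = inducedVectorField x m

variable (G E) in
/-- The action of `G` on `(M, π)` is weakly Hamiltonian if it has a moment map. -/
def IsWeaklyHamiltonian {M : Type*} [TopologicalSpace M] [ChartedSpace F M] [MulAction G M]
    (π : ∀ m : M, TangentSpace 𝓘(𝕜, F) m ⊗[𝕜] TangentSpace 𝓘(𝕜, F) m) : Prop :=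
  ∃ J : M → Module.Dual 𝕜 (GroupLieAlgebra 𝓘(𝕜, E) G), IsMomentMap π J

/-! ### Structures on a Lie group -/

/-- The derivative at the identity of the left translation by `g`, so that
`leftTranslation g x` is the value at `g` of the left invariant vector field of `x`. -/
def leftTranslation (g : G) :
    GroupLieAlgebra 𝓘(𝕜, E) G →ₗ[𝕜] TangentSpace 𝓘(𝕜, E) g where
  toFun x := mulInvariantVectorField x g
  map_add' x y := map_add (mfderiv 𝓘(𝕜, E) 𝓘(𝕜, E) (fun h : G => g * h) 1) x y
  map_smul' c x := map_smul (mfderiv 𝓘(𝕜, E) 𝓘(𝕜, E) (fun h : G => g * h) 1) c x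

/-- The left invariant bivector field `𝓛_r` on `G`. -/
def leftInvariantBivector
    (r : GroupLieAlgebra 𝓘(𝕜, E) G ⊗[𝕜] GroupLieAlgebra 𝓘(𝕜, E) G) (g : G) :
    TangentSpace 𝓘(𝕜, E) g ⊗[𝕜] TangentSpace 𝓘(𝕜, E) g :=
  TensorProduct.map (leftTranslation g) (leftTranslation g) r

/-- The adjoint action: the derivative at the identity of `h ↦ g h g⁻¹`. -/
def adjoint (g : G) (x : GroupLieAlgebra 𝓘(𝕜, E) G) : GroupLieAlgebra 𝓘(𝕜, E) G :=
  mfderiv 𝓘(𝕜, E) 𝓘(𝕜, E) (fun h : G => g * h * g⁻¹) 1 x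

/-- A smooth group `1`-cocycle `B : G → 𝔤*` for the coadjoint action
`⟨Ad*_g ξ, x⟩ = ⟨ξ, Ad_{g⁻¹} x⟩`, i.e. `B(gh) = B(g) + Ad*_g B(h)`. -/
def IsGroupCocycle (B : G → Module.Dual 𝕜 (GroupLieAlgebra 𝓘(𝕜, E) G)) : Prop :=
  IsSmoothToDual (F := E) B ∧
    ∀ (g h : G) (x : GroupLieAlgebra 𝓘(𝕜, E) G), B (g * h) x = B g x + B h (adjoint g⁻¹ x)

/-- The differential at the identity of `B : G → 𝔤*` is the linear map `γ : 𝔤 → 𝔤*`. -/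
def HasDifferentialAtOne (B : G → Module.Dual 𝕜 (GroupLieAlgebra 𝓘(𝕜, E) G))
    (γ : GroupLieAlgebra 𝓘(𝕜, E) G →ₗ[𝕜] Module.Dual 𝕜 (GroupLieAlgebra 𝓘(𝕜, E) G)) : Prop :=
  ∀ x y : GroupLieAlgebra 𝓘(𝕜, E) G, differential (F := E) (fun g => B g y) 1 x = γ x y

/-- `γ : 𝔤 → 𝔤*` is a coboundary for the coadjoint action of `𝔤`: for some `ξ ∈ 𝔤*` one has
`γ(x) = ad*_x ξ`, where `⟨ad*_x ξ, y⟩ = -⟨ξ, [x, y]⟩`. -/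
def IsLieCoboundary
    (γ : GroupLieAlgebra 𝓘(𝕜, E) G →ₗ[𝕜] Module.Dual 𝕜 (GroupLieAlgebra 𝓘(𝕜, E) G)) : Prop :=
  ∃ ξ : Module.Dual 𝕜 (GroupLieAlgebra 𝓘(𝕜, E) G),
    ∀ x y : GroupLieAlgebra 𝓘(𝕜, E) G, γ x y = -ξ ⁅x, y⁆

variable [FiniteDimensional 𝕜 E]

instance instFiniteDimensionalGroupLieAlgebra :
    FiniteDimensional 𝕜 (GroupLieAlgebra 𝓘(𝕜, E) G) :=
  inferInstanceAs (FiniteDimensional 𝕜 E)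

/-- `r ∈ 𝔤 ⊗ 𝔤` solves the classical Yang-Baxter equation, where `𝔤` is the Lie algebra of the
Lie group `G`. -/
def SolvesYangBaxter [LieGroup 𝓘(𝕜, E) ∞ G]
    (r : GroupLieAlgebra 𝓘(𝕜, E) G ⊗[𝕜] GroupLieAlgebra 𝓘(𝕜, E) G) : Prop :=
  haveI : CompleteSpace E := FiniteDimensional.complete 𝕜 E
  haveI : LieGroup 𝓘(𝕜, E) (minSmoothness 𝕜 3) G := by
    rw [minSmoothness_of_isRCLikeNormedField]; infer_instance
  yangBaxter (k := 𝕜) (L := GroupLieAlgebra 𝓘(𝕜, E) G) r = 0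

end Manifolds

end TriangularPoisson

end

/-!
Trivialize `TG` by left translations and write `γ = ř⁻¹ : 𝔤 → 𝔤*`. Two facts about `γ` carry the
argument: since `r` is skew, `γ(x)(y)` is skew in `x` and `y` (`rCheckInv_skew`), and the classical
Yang-Baxter equation, contracted with three covectors, says that `γ` is a 2-cocycle of `𝔤`
(`rCheckInv_cocycle`).

The vector field induced by `x` is right invariant, so in the left trivialization it is
`g ↦ Ad_{g⁻¹} x`. Hence `J` is a moment map if and only if, for all `x`, `g` and all tangent vectors
`v` at `g`, with left Maurer-Cartan form `ω`, one has `dJ*(x)(v) = γ(Ad_{g⁻¹} x)(ω(v))`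
(`isMomentMap_iff`). On the other hand, a cocycle `B` with `d_e B = γ` satisfies
`d⟨B, x⟩(v) = γ(ω(v))(Ad_{g⁻¹} x)` (`modelDeriv_of_isGroupCocycle`), and on a connected group every
`B` with `B(1) = 0` satisfying this equation is such a cocycle (`isGroupCocycle_of_modelDeriv`). By
skewness the two equations differ by a sign, so that `J = -B` and `B = J(1) - J` translate one
condition into the other.

It remains to solve the equation for `B`. If `γ` is the coboundary of `ξ`, then
`B(g) = Ad*_g ξ - ξ` is a solution on any group. On a simply connected group, the 1-form
`v ↦ γ(ω(v))(Ad_{g⁻¹} x)` is closed, by the Maurer-Cartan equation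
(`fderiv_maurerCartanChart_sub`), the formula `d(Ad_{g⁻¹} x) = -[ω, Ad_{g⁻¹} x]`
(`modelDeriv_adjointCLM_inv`) and the 2-cocycle identity. The Poincaré lemma on balls in charts
gives local primitives (`exists_local_primitive`), and the germs of primitives form a covering space
of `G`, which has a global section (`exists_glue_of_locallyConstant_sub`,
`exists_primitive_of_locally_exact`).
-/

namespace TriangularPoisson

/-! ### Nondegenerate skew tensors and the classical Yang-Baxter equation -/

section Tensors

variable {k L : Type*} [Field k] [AddCommGroup L] [Module k L]

lemma rCheck_tmul (a b : L) (ξ : Module.Dual k L) : rCheck (a ⊗ₜ[k] b) ξ = ξ a • b := by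
  simp [rCheck, contract]

lemma rCheck_add (r s : L ⊗[k] L) (ξ : Module.Dual k L) :
    rCheck (r + s) ξ = rCheck r ξ + rCheck s ξ := by
  simp [rCheck, contract]

lemma rCheck_zero (ξ : Module.Dual k L) : rCheck (0 : L ⊗[k] L) ξ = 0 := by
  simp [rCheck, contract]

lemma rCheck_neg (r : L ⊗[k] L) (ξ : Module.Dual k L) : rCheck (-r) ξ = -rCheck r ξ := by
  simp [rCheck, contract]

lemma contract_map {M : Type*} [AddCommGroup M] [Module k M] (ℓ : L →ₗ[k] M)
    (ξ : Module.Dual k M) (r : L ⊗[k] L) :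
    contract ξ (TensorProduct.map ℓ ℓ r) = ℓ (contract (ξ ∘ₗ ℓ) r) := by
  induction r using TensorProduct.induction_on with
  | zero => simp [contract]
  | tmul a b => simp [contract]
  | add a b ha hb =>
    simp only [contract, map_add] at ha hb ⊢
    rw [ha, hb]

/-- The transpose of `ř` is the map attached to the flipped tensor. -/
lemma apply_rCheck_comm (r : L ⊗[k] L) (ξ η : Module.Dual k L) :
    η (rCheck (TensorProduct.comm k L L r) ξ) = ξ (rCheck r η) := by
  induction r using TensorProduct.induction_on with
  | zero => simp [rCheck_zero]
  | add r₁ r₂ h₁ h₂ => simp [rCheck_add, h₁, h₂]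
  | tmul a b => simp [rCheck_tmul, mul_comm]

variable [FiniteDimensional k L] {r : L ⊗[k] L}

lemma rCheck_rCheckInv (h : IsNondegenerate r) (x : L) : rCheck r (rCheckInv r h x) = x :=
  (LinearEquiv.ofBijective (rCheck r) (rCheck_bijective h)).apply_symm_apply x

lemma rCheckInv_rCheck (h : IsNondegenerate r) (ξ : Module.Dual k L) :
    rCheckInv r h (rCheck r ξ) = ξ :=
  (LinearEquiv.ofBijective (rCheck r) (rCheck_bijective h)).symm_apply_apply ξ

lemma contract_eq_iff (h : IsNondegenerate r) (ξ : Module.Dual k L) (x : L) :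
    contract ξ r = x ↔ ξ = rCheckInv r h x := by
  constructor
  · rintro rfl
    exact (rCheckInv_rCheck h ξ).symm
  · rintro rfl
    exact rCheck_rCheckInv h x

/-- Contracting the pushforward of `r` under a bijective linear map `ℓ` with inverse `κ`. -/
lemma contract_map_eq_iff (h : IsNondegenerate r) {M : Type*} [AddCommGroup M] [Module k M]
    (ℓ : L →ₗ[k] M) (κ : M → L) (hκℓ : ∀ x, κ (ℓ x) = x) (hℓκ : ∀ v, ℓ (κ v) = v)
    (ξ : Module.Dual k M) (x : L) :
    contract ξ (TensorProduct.map ℓ ℓ r) = ℓ x ↔ ∀ v, ξ v = rCheckInv r h x (κ v) := by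
  have hinj : Function.Injective ℓ := Function.LeftInverse.injective hκℓ
  rw [contract_map, hinj.eq_iff, contract_eq_iff h]
  constructor
  · intro h2 v
    rw [← h2, LinearMap.comp_apply, hℓκ]
  · intro h2
    ext v
    rw [LinearMap.comp_apply, h2, hκℓ]

lemma rCheckInv_skew (hskew : IsSkew r) (h : IsNondegenerate r) (x y : L) :
    rCheckInv r h x y = -rCheckInv r h y x := by
  have := apply_rCheck_comm r (rCheckInv r h x) (rCheckInv r h y)
  rw [hskew, rCheck_neg, map_neg, rCheck_rCheckInv, rCheck_rCheckInv] at this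
  exact this.symm

end Tensors

section YangBaxterCocycle

variable {k L : Type*} [Field k] [LieRing L] [LieAlgebra k L]

/-- The contraction of a tensor in `L ⊗ L ⊗ L` with three covectors. -/
noncomputable def contract₃ (ξ η ζ : Module.Dual k L) : L ⊗[k] (L ⊗[k] L) →ₗ[k] k :=
  TensorProduct.dualDistrib k L (L ⊗[k] L) (ξ ⊗ₜ TensorProduct.dualDistrib k L L (η ⊗ₜ ζ))

lemma contract₃_bracket1213 (ξ η ζ : Module.Dual k L) (r s : L ⊗[k] L) :
    contract₃ ξ η ζ (bracket1213 k L (r ⊗ₜ s)) =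
      ξ ⁅rCheck (TensorProduct.comm k L L r) η, rCheck (TensorProduct.comm k L L s) ζ⁆ := by
  induction r using TensorProduct.induction_on with
  | zero => simp [rCheck_zero]
  | add r₁ r₂ h₁ h₂ => simp [TensorProduct.add_tmul, rCheck_add, h₁, h₂]
  | tmul a b =>
    induction s using TensorProduct.induction_on with
    | zero => simp [rCheck_zero]
    | add r₁ r₂ h₁ h₂ => simp [TensorProduct.tmul_add, rCheck_add, h₁, h₂]
    | tmul c d =>
      simp [contract₃, bracket1213, bracketMap, rCheck_tmul]
      ring

lemma contract₃_bracket1223 (ξ η ζ : Module.Dual k L) (r s : L ⊗[k] L) :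
    contract₃ ξ η ζ (bracket1223 k L (r ⊗ₜ s)) =
      η ⁅rCheck r ξ, rCheck (TensorProduct.comm k L L s) ζ⁆ := by
  induction r using TensorProduct.induction_on with
  | zero => simp [rCheck_zero]
  | add r₁ r₂ h₁ h₂ => simp [TensorProduct.add_tmul, rCheck_add, h₁, h₂]
  | tmul a b =>
    induction s using TensorProduct.induction_on with
    | zero => simp [rCheck_zero]
    | add r₁ r₂ h₁ h₂ => simp [TensorProduct.tmul_add, rCheck_add, h₁, h₂]
    | tmul c d =>
      simp [contract₃, bracket1223, bracketMap, rCheck_tmul]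
      ring

lemma contract₃_bracket1323 (ξ η ζ : Module.Dual k L) (r s : L ⊗[k] L) :
    contract₃ ξ η ζ (bracket1323 k L (r ⊗ₜ s)) = ζ ⁅rCheck r ξ, rCheck s η⁆ := by
  induction r using TensorProduct.induction_on with
  | zero => simp [rCheck_zero]
  | add r₁ r₂ h₁ h₂ => simp [TensorProduct.add_tmul, rCheck_add, h₁, h₂]
  | tmul a b =>
    induction s using TensorProduct.induction_on with
    | zero => simp [rCheck_zero]
    | add r₁ r₂ h₁ h₂ => simp [TensorProduct.tmul_add, rCheck_add, h₁, h₂]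
    | tmul c d =>
      simp [contract₃, bracket1323, bracketMap, rCheck_tmul]
      ring

/-- For a nondegenerate skew `r`, the bilinear form `ř⁻¹` on the Lie algebra is a 2-cocycle: this is
the classical Yang-Baxter equation contracted with `ř⁻¹ x`, `ř⁻¹ y` and `ř⁻¹ z`. -/
lemma rCheckInv_cocycle [FiniteDimensional k L] {r : L ⊗[k] L}
    (hskew : IsSkew r) (h : IsNondegenerate r) (hr : yangBaxter r = 0) (x y z : L) :
    rCheckInv r h x ⁅y, z⁆ - rCheckInv r h y ⁅x, z⁆ + rCheckInv r h z ⁅x, y⁆ = 0 := by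
  have := congrArg (contract₃ (rCheckInv r h x) (rCheckInv r h y) (rCheckInv r h z)) hr
  rw [yangBaxter, map_add, map_add, contract₃_bracket1213, contract₃_bracket1223,
    contract₃_bracket1323, hskew, map_zero] at this
  simp only [rCheck_neg, rCheck_rCheckInv, lie_neg, neg_lie, neg_neg, map_neg] at this
  rw [← this]; ring

end YangBaxterCocycle

/-! ### Closed forms on simply connected spaces -/

section Monodromy

open Filter Topology

/-- A copy of a type carrying the discrete topology, used as the fibre of a covering space. -/
def DiscreteCopy (A : Type*) : Type _ := A

instance (A : Type*) : TopologicalSpace (DiscreteCopy A) := ⊥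

instance (A : Type*) : DiscreteTopology (DiscreteCopy A) := ⟨rfl⟩

/-- Local functions which differ by locally constant functions on overlaps glue, up to locally
constant functions, to a global function on a simply connected space: the germs `f i + const`
form a covering space, which has a global section. -/
theorem exists_glue_of_locallyConstant_sub {X A : Type*} [TopologicalSpace X]
    [SimplyConnectedSpace X] [LocallyPathConnectedSpace X] [AddCommGroup A]
    (U : X → Set X) (hU : ∀ i, IsOpen (U i)) (hmem : ∀ x, x ∈ U x) (f : X → X → A)
    (hf : ∀ i j, ∀ x ∈ U i ∩ U j, ∀ᶠ y in 𝓝 x, f i y - f j y = f i x - f j x) :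
    ∃ F : X → A, ∀ i, ∀ x ∈ U i, ∀ᶠ y in 𝓝 x, F y - f i y = F x - f i x := by
  -- In the chart `i`, a germ is given by the value `v` for which it is the germ of `f i + v`.
  let c : X → X → X → DiscreteCopy A → DiscreteCopy A :=
    fun i j x v => ((show A from v) + (f i x - f j x) : A)
  let Z : FiberBundleCore X X (DiscreteCopy A) :=
    { baseSet := U
      isOpen_baseSet := hU
      indexAt := id
      mem_baseSet_at := hmem
      coordChange := c
      coordChange_self := fun i x _ v => by
        have : ∀ a : A, a + (f i x - f i x) = a := by simp
        exact this v
      continuousOn_coordChange := fun i j => by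
        rintro ⟨x, v⟩ ⟨hx, -⟩
        refine ContinuousAt.continuousWithinAt ?_
        refine (continuousAt_const (y := c i j x v)).congr ?_
        have h2 : ∀ᶠ w : DiscreteCopy A in 𝓝 v, w = v := by simp [nhds_discrete]
        filter_upwards [(hf i j x hx).prod_nhds h2] with p hp
        change _ = ((show A from p.2) + (f i p.1 - f j p.1) : A)
        rw [hp.1, hp.2]
      coordChange_comp := fun i j k x _ v => by
        change (show A from v) + (f i x - f j x) + (f j x - f k x) =
          (show A from v) + (f i x - f k x)
        abel }
  have hcov : IsCoveringMap (Bundle.TotalSpace.proj : Z.TotalSpace → X) :=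
    FiberBundle.isCoveringMap
  obtain ⟨x₀⟩ : Nonempty X := inferInstance
  obtain ⟨s, ⟨-, hs⟩, -⟩ := hcov.existsUnique_continuousMap_lifts (ContinuousMap.id X) x₀
    (⟨x₀, (0 : A)⟩ : Z.TotalSpace) rfl
  have hs' : ∀ x, (s x).proj = x := fun x => congrFun hs x
  -- The section `s` chooses a germ at each point, and the function sought is its value there.
  refine ⟨fun x => f x x + (show A from (s x).2), fun i x hx => ?_⟩
  have key : ∀ y, (show A from ((Z.localTriv i) (s y)).2) =
      f y y + (show A from (s y).2) - f i y := fun y => by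
    change (show A from (s y).2) + (f (s y).proj (s y).proj - f i (s y).proj) = _
    rw [hs' y]
    abel
  have hc : ContinuousAt (fun y => ((Z.localTriv i) (s y)).2) x := by
    refine continuousAt_snd.comp (ContinuousAt.comp ?_ s.continuous.continuousAt)
    refine (Z.localTriv i).continuousAt ?_
    rw [Z.mem_localTriv_source]
    change (s x).proj ∈ U i
    rwa [hs' x]
  have := hc.eventually (p := fun w => w = ((Z.localTriv i) (s x)).2)
    (by simp [nhds_discrete])
  filter_upwards [this] with y hy
  rw [← key, ← key]
  exact hy

end Monodromy

section Primitives

open Filter Topology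

variable {𝕜 : Type*} [RCLike 𝕜] {E : Type*} [NormedAddCommGroup E] [NormedSpace 𝕜 E]
  {M : Type*} [TopologicalSpace M] [ChartedSpace E M] [IsManifold 𝓘(𝕜, E) ∞ M]
  {F : Type*} [NormedAddCommGroup F] [NormedSpace 𝕜 F]

/-- A function with zero differential on an open set is locally constant there. -/
lemma eventually_eq_of_hasMFDerivAt_zero {U : Set M} (hU : IsOpen U) {f : M → F}
    (hf : ∀ x ∈ U, HasMFDerivAt 𝓘(𝕜, E) 𝓘(𝕜, F) f x 0) {x : M} (hx : x ∈ U) :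
    ∀ᶠ y in 𝓝 x, f y = f x := by
  set φ := chartAt E x
  have hs : IsOpen (φ.target ∩ φ.symm ⁻¹' U) := φ.isOpen_inter_preimage_symm hU
  have hd : ∀ z ∈ φ.target ∩ φ.symm ⁻¹' U, HasFDerivAt (f ∘ φ.symm) (0 : E →L[𝕜] F) z := by
    intro z hz
    have h1 : MDifferentiableAt 𝓘(𝕜, E) 𝓘(𝕜, E) φ.symm z :=
      mdifferentiableAt_atlas_symm (chart_mem_atlas E x) hz.1
    have h2 := (hf _ hz.2).comp z h1.hasMFDerivAt
    rw [ContinuousLinearMap.zero_comp] at h2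
    exact hasMFDerivAt_iff_hasFDerivAt.1 h2
  let _ : NormedSpace ℝ E := NormedSpace.restrictScalars ℝ 𝕜 E
  have hopen := hs.isOpen_inter_preimage_of_fderiv_eq_zero
    (fun z hz => (hd z hz).differentiableAt.differentiableWithinAt)
    (fun z hz => (hd z hz).fderiv) {f x}
  have hxs : x ∈ φ.source := mem_chart_source E x
  have hmem : φ x ∈ φ.target ∩ φ.symm ⁻¹' U ∩ (f ∘ φ.symm) ⁻¹' {f x} := by
    simp [φ.map_source hxs, φ.left_inv hxs, hx]
  filter_upwards [(φ.continuousAt hxs).eventually (hopen.mem_nhds hmem),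
    φ.open_source.mem_nhds hxs] with y hy hys
  simpa [φ.left_inv hys] using hy.2

/-- A function with zero differential on a connected manifold is constant. -/
lemma eq_of_hasMFDerivAt_zero [PreconnectedSpace M] {f : M → F}
    (hf : ∀ x, HasMFDerivAt 𝓘(𝕜, E) 𝓘(𝕜, F) f x 0) (x y : M) : f x = f y := by
  have : IsLocallyConstant f := (IsLocallyConstant.iff_eventually_eq f).2 fun x =>
    eventually_eq_of_hasMFDerivAt_zero isOpen_univ (fun y _ => hf y) (Set.mem_univ x)
  exact this.apply_eq_of_isPreconnected isPreconnected_univ (Set.mem_univ x) (Set.mem_univ y)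

/-- A locally exact 1-form with smooth local primitives on a simply connected manifold is exact. -/
theorem exists_primitive_of_locally_exact [SimplyConnectedSpace M]
    (θ : ∀ m : M, TangentSpace 𝓘(𝕜, E) m →L[𝕜] F)
    (h : ∀ m : M, ∃ U : Set M, IsOpen U ∧ m ∈ U ∧ ∃ f : M → F, ∀ x ∈ U,
      HasMFDerivAt 𝓘(𝕜, E) 𝓘(𝕜, F) f x (θ x) ∧ ContMDiffAt 𝓘(𝕜, E) 𝓘(𝕜, F) ∞ f x) :
    ∃ f : M → F, ContMDiff 𝓘(𝕜, E) 𝓘(𝕜, F) ∞ f ∧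
      ∀ x, HasMFDerivAt 𝓘(𝕜, E) 𝓘(𝕜, F) f x (θ x) := by
  choose U hU hmem f hf using h
  let _ : NormedSpace ℝ E := NormedSpace.restrictScalars ℝ 𝕜 E
  have _ : LocallyPathConnectedSpace M := ChartedSpace.locallyPathConnectedSpace E M
  obtain ⟨g, hg⟩ := exists_glue_of_locallyConstant_sub U hU hmem f (fun i j x hx =>
    eventually_eq_of_hasMFDerivAt_zero (𝕜 := 𝕜) (E := E) (f := fun y => f i y - f j y)
      ((hU i).inter (hU j))
      (fun y hy => by
        have := (hf i y hy.1).1.sub (hf j y hy.2).1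
        rwa [sub_self] at this) hx)
  have hloc : ∀ x, g =ᶠ[𝓝 x] fun y => f x y + (g x - f x x) := fun x => by
    filter_upwards [hg x x (hmem x)] with y hy
    rw [← hy]; abel
  refine ⟨g, fun x => ?_, fun x => ?_⟩
  · exact ((hf x x (hmem x)).2.add contMDiffAt_const).congr_of_eventuallyEq (hloc x)
  · have := (hf x x (hmem x)).1.add (hasMFDerivAt_const (I := 𝓘(𝕜, E)) (I' := 𝓘(𝕜, F))
      (g x - f x x) x)
    exact (this.congr_of_eventuallyEq (hloc x)).congr_mfderiv (add_zero _)

end Primitives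

/-! ### Differentials read in the model spaces -/

section ModelDeriv

open Filter Topology

variable (𝕜 : Type*) [RCLike 𝕜] (E E' : Type*) [NormedAddCommGroup E] [NormedSpace 𝕜 E]
  [NormedAddCommGroup E'] [NormedSpace 𝕜 E']

/-- The manifold derivative, viewed as a linear map between the model spaces. The tangent space at
a point is by definition the model space, and this form of the derivative makes it possible to
compare derivatives at points which are equal, but not definitionally so. -/
noncomputable def modelDeriv {M M' : Type*} [TopologicalSpace M] [ChartedSpace E M]
    [TopologicalSpace M'] [ChartedSpace E' M'] (f : M → M') (x : M) : E →L[𝕜] E' :=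
  mfderiv 𝓘(𝕜, E) 𝓘(𝕜, E') f x

variable {𝕜 E E'} {E'' : Type*} [NormedAddCommGroup E''] [NormedSpace 𝕜 E'']
  {M M' M'' : Type*} [TopologicalSpace M] [ChartedSpace E M]
  [TopologicalSpace M'] [ChartedSpace E' M'] [TopologicalSpace M''] [ChartedSpace E'' M'']

lemma modelDeriv_comp {f : M → M'} {g : M' → M''} {x : M} {y : M'}
    (hg : MDifferentiableAt 𝓘(𝕜, E') 𝓘(𝕜, E'') g y) (hf : MDifferentiableAt 𝓘(𝕜, E) 𝓘(𝕜, E') f x)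
    (hy : f x = y) :
    modelDeriv 𝕜 E E'' (g ∘ f) x = (modelDeriv 𝕜 E' E'' g y).comp (modelDeriv 𝕜 E E' f x) := by
  subst hy
  exact mfderiv_comp x hg hf

lemma modelDeriv_id (x : M) : modelDeriv 𝕜 E E (id : M → M) x = ContinuousLinearMap.id 𝕜 E :=
  mfderiv_id

lemma modelDeriv_eq_fderiv (f : E → E') (x : E) : modelDeriv 𝕜 E E' f x = fderiv 𝕜 f x :=
  mfderiv_eq_fderiv

lemma modelDeriv_congr {f g : M → M'} {x : M} (h : f =ᶠ[𝓝 x] g) :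
    modelDeriv 𝕜 E E' f x = modelDeriv 𝕜 E E' g x :=
  h.mfderiv_eq

lemma modelDeriv_chart [IsManifold 𝓘(𝕜, E) 1 M] (x : M) :
    modelDeriv 𝕜 E E (extChartAt 𝓘(𝕜, E) x) x = ContinuousLinearMap.id 𝕜 E :=
  mfderiv_extChartAt_self

lemma modelDeriv_chart_symm [IsManifold 𝓘(𝕜, E) 1 M] (x : M) :
    modelDeriv 𝕜 E E (extChartAt 𝓘(𝕜, E) x).symm (extChartAt 𝓘(𝕜, E) x x) =
      ContinuousLinearMap.id 𝕜 E := by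
  have := mfderivWithin_range_extChartAt_symm (I := 𝓘(𝕜, E)) (x := x)
  rw [ModelWithCorners.range_eq_univ, mfderivWithin_univ] at this
  exact this

/-- A family of differentials `d(f x)` at `g x` of maps with `f x (g x) = y` depends smoothly
on `x` when all points `g x` share their preferred chart. -/
lemma contMDiffAt_modelDeriv {EN : Type*} [NormedAddCommGroup EN] [NormedSpace 𝕜 EN]
    {N : Type*} [TopologicalSpace N] [ChartedSpace EN N] [IsManifold 𝓘(𝕜, EN) ∞ N]
    [IsManifold 𝓘(𝕜, E) ∞ M] [IsManifold 𝓘(𝕜, E') ∞ M']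
    {f : N → M → M'} {g : N → M} {x₀ : N} {y : M'}
    (hf : ContMDiffAt (𝓘(𝕜, EN).prod 𝓘(𝕜, E)) 𝓘(𝕜, E') ∞ (Function.uncurry f) (x₀, g x₀))
    (hg : ContMDiffAt 𝓘(𝕜, EN) 𝓘(𝕜, E) ∞ g x₀)
    (hchart : ∀ x, achart E (g x) = achart E (g x₀)) (hy : ∀ x, f x (g x) = y) :
    ContMDiffAt 𝓘(𝕜, EN) 𝓘(𝕜, E →L[𝕜] E') ∞ (fun x => modelDeriv 𝕜 E E' (f x) (g x)) x₀ := by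
  have : IsManifold 𝓘(𝕜, E) 1 M := .of_le (n := ∞) (by norm_cast)
  have : IsManifold 𝓘(𝕜, E') 1 M' := .of_le (n := ∞) (by norm_cast)
  have h : ContMDiffAt 𝓘(𝕜, EN) 𝓘(𝕜, E →L[𝕜] E') ∞ (inTangentCoordinates 𝓘(𝕜, E) 𝓘(𝕜, E') g
      (fun x => f x (g x)) (fun x => modelDeriv 𝕜 E E' (f x) (g x)) x₀) x₀ :=
    ContMDiffAt.mfderiv f g hf hg le_rfl
  refine h.congr_of_eventuallyEq (.of_forall fun x => ?_)
  have hx : g x ∈ (chartAt E (g x₀)).source := by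
    rw [← coe_achart, ← hchart x]
    exact mem_chart_source E (g x)
  rw [inTangentCoordinates_eq _ _ _ hx (by simp [hy])]
  ext v
  have h1 := (tangentBundleCore 𝓘(𝕜, E) M).coordChange_self (achart E (g x₀)) (g x) hx
  have h2 := (tangentBundleCore 𝓘(𝕜, E') M').coordChange_self (achart E' y) y
    (mem_chart_source E' y)
  simp only [ContinuousLinearMap.comp_apply, hchart x, hy]
  rw [h1]
  exact (h2 _).symm

end ModelDeriv

/-! ### Left translations and the adjoint action -/

section LieGroups

open Filter Topology VectorField

variable (𝕜 : Type*) [RCLike 𝕜] (E : Type*) [NormedAddCommGroup E] [NormedSpace 𝕜 E]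
  {G : Type*} [TopologicalSpace G] [ChartedSpace E G] [Group G]

/-- The adjoint action `Ad_g`, as a continuous linear map on the model space `E = 𝔤`. -/
noncomputable def adjointCLM (g : G) : E →L[𝕜] E :=
  modelDeriv 𝕜 E E (fun h : G => g * h * g⁻¹) 1

/-- The left Maurer-Cartan form `T_g G → 𝔤`. -/
noncomputable def maurerCartan (g : G) : E →L[𝕜] E :=
  modelDeriv 𝕜 E E (fun h : G => g⁻¹ * h) g

/-- The differential at the identity of the left translation by `g`; it is inverse to
`maurerCartan`. -/
noncomputable def leftCLM (g : G) : E →L[𝕜] E :=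
  modelDeriv 𝕜 E E (fun h : G => g * h) 1

variable {𝕜 E}

variable (𝕜) in
/-- The pullback of the left Maurer-Cartan form under the inverse of the chart at `g₀`, written as
a single derivative so that its smoothness in `z` is apparent. -/
noncomputable def maurerCartanChart (g₀ : G) (z : E) : E →L[𝕜] E :=
  modelDeriv 𝕜 E E
    (fun z' : E => ((extChartAt 𝓘(𝕜, E) g₀).symm z)⁻¹ * (extChartAt 𝓘(𝕜, E) g₀).symm z') z

variable (𝕜) in
/-- The left invariant vector field of `y`, read in the chart at `g₀`. -/
noncomputable def leftFieldChart (g₀ : G) (y z : E) : E :=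
  mpullback 𝓘(𝕜, E) 𝓘(𝕜, E) (extChartAt 𝓘(𝕜, E) g₀).symm
      (mulInvariantVectorField (I := 𝓘(𝕜, E)) (G := G) y) z

variable (𝕜 G) in
/-- The Lie bracket of the Lie algebra of `G`, viewed on the model space. -/
noncomputable def modelBracket (x y : E) : E :=
  mlieBracket 𝓘(𝕜, E) (mulInvariantVectorField (I := 𝓘(𝕜, E)) (G := G) x)
    (mulInvariantVectorField (I := 𝓘(𝕜, E)) (G := G) y) 1

lemma leftFieldChart_eq (g₀ : G) (y z : E) :
    leftFieldChart 𝕜 g₀ y z = (modelDeriv 𝕜 E E (extChartAt 𝓘(𝕜, E) g₀).symm z).inverse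
      (leftCLM 𝕜 E ((extChartAt 𝓘(𝕜, E) g₀).symm z) y) := rfl

lemma adjointCLM_one : adjointCLM 𝕜 E (1 : G) = ContinuousLinearMap.id 𝕜 E := by
  have h' : (fun k : G => (1 : G) * k * (1 : G)⁻¹) = id := by ext; simp
  rw [adjointCLM, h', modelDeriv_id]

variable [LieGroup 𝓘(𝕜, E) ∞ G]

lemma mdifferentiableAt_mul_left (g h : G) :
    MDifferentiableAt 𝓘(𝕜, E) 𝓘(𝕜, E) (fun k : G => g * k) h :=
  (contMDiff_mul_left (I := 𝓘(𝕜, E)) (n := ∞)).mdifferentiableAt (by simp)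

lemma mdifferentiableAt_mul_right (g h : G) :
    MDifferentiableAt 𝓘(𝕜, E) 𝓘(𝕜, E) (fun k : G => k * g) h :=
  (contMDiff_mul_right (I := 𝓘(𝕜, E)) (n := ∞)).mdifferentiableAt (by simp)

lemma mdifferentiableAt_conj (g h : G) :
    MDifferentiableAt 𝓘(𝕜, E) 𝓘(𝕜, E) (fun k : G => g * k * g⁻¹) h :=
  (mdifferentiableAt_mul_right (𝕜 := 𝕜) (E := E) g⁻¹ (g * h)).comp h
    (mdifferentiableAt_mul_left g h)

lemma maurerCartan_leftCLM (g : G) (x : E) : maurerCartan 𝕜 E g (leftCLM 𝕜 E g x) = x := by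
  have h := modelDeriv_comp (mdifferentiableAt_mul_left (𝕜 := 𝕜) (E := E) g⁻¹ g)
    (mdifferentiableAt_mul_left (𝕜 := 𝕜) (E := E) g 1) (mul_one g)
  have h' : (fun k : G => g⁻¹ * k) ∘ (fun k : G => g * k) = id := by ext; simp
  rw [h', modelDeriv_id] at h
  exact (DFunLike.congr_fun h x).symm

lemma leftCLM_maurerCartan (g : G) (v : E) : leftCLM 𝕜 E g (maurerCartan 𝕜 E g v) = v := by
  have h := modelDeriv_comp (mdifferentiableAt_mul_left (𝕜 := 𝕜) (E := E) g 1)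
    (mdifferentiableAt_mul_left (𝕜 := 𝕜) (E := E) g⁻¹ g) (inv_mul_cancel g)
  have h' : (fun k : G => g * k) ∘ (fun k : G => g⁻¹ * k) = id := by ext; simp
  rw [h', modelDeriv_id] at h
  exact (DFunLike.congr_fun h v).symm

lemma adjointCLM_mul (g h : G) :
    adjointCLM 𝕜 E (g * h) = (adjointCLM 𝕜 E g).comp (adjointCLM 𝕜 E h) := by
  have := modelDeriv_comp (mdifferentiableAt_conj (𝕜 := 𝕜) (E := E) g 1)
    (mdifferentiableAt_conj (𝕜 := 𝕜) (E := E) h 1) (by simp)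
  have h' : (fun k : G => g * k * g⁻¹) ∘ (fun k : G => h * k * h⁻¹) =
      fun k => (g * h) * k * (g * h)⁻¹ := by ext; simp [mul_assoc]
  rw [h'] at this
  exact this

/-- In the left trivialization of the tangent bundle, the right invariant vector field of `x`
has the value `Ad_{g⁻¹} x` at `g`. -/
lemma modelDeriv_mul_right (g : G) :
    modelDeriv 𝕜 E E (fun k : G => k * g) 1 =
      (leftCLM 𝕜 E g).comp (adjointCLM 𝕜 E g⁻¹) := by
  have := modelDeriv_comp (mdifferentiableAt_mul_left (𝕜 := 𝕜) (E := E) g 1)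
    (mdifferentiableAt_conj (𝕜 := 𝕜) (E := E) g⁻¹ 1) (by simp)
  have h' : (fun k : G => g * k) ∘ (fun k : G => g⁻¹ * k * g⁻¹⁻¹) = fun k => k * g := by
    ext; simp [mul_assoc]
  rw [h'] at this
  exact this

lemma contMDiff_adjointCLM_inv :
    ContMDiff 𝓘(𝕜, E) 𝓘(𝕜, E →L[𝕜] E) ∞ (fun g : G => adjointCLM 𝕜 E g⁻¹) := by
  intro g₀
  refine contMDiffAt_modelDeriv (f := fun g h : G => g⁻¹ * h * g⁻¹⁻¹)
    (g := fun _ : G => (1 : G)) (y := 1) ?_ contMDiffAt_const (fun _ => rfl) (by simp)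
  have h1 : ContMDiff (𝓘(𝕜, E).prod 𝓘(𝕜, E)) 𝓘(𝕜, E) ∞ (fun p : G × G => p.1⁻¹) :=
    contMDiff_fst.inv
  exact ((h1.mul contMDiff_snd).mul h1.inv).contMDiffAt

/-! ### The Maurer-Cartan form in a chart -/

lemma contMDiffAt_chart_symm {g₀ : G} {z : E} (hz : z ∈ (extChartAt 𝓘(𝕜, E) g₀).target) :
    ContMDiffAt 𝓘(𝕜, E) 𝓘(𝕜, E) ∞ (extChartAt 𝓘(𝕜, E) g₀).symm z :=
  (contMDiffOn_extChartAt_symm g₀).contMDiffAt ((isOpen_extChartAt_target g₀).mem_nhds hz)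

lemma mdifferentiableAt_chart_symm {g₀ : G} {z : E} (hz : z ∈ (extChartAt 𝓘(𝕜, E) g₀).target) :
    MDifferentiableAt 𝓘(𝕜, E) 𝓘(𝕜, E) (extChartAt 𝓘(𝕜, E) g₀).symm z :=
  (contMDiffAt_chart_symm hz).mdifferentiableAt (by simp)

lemma contDiffAt_maurerCartanChart {g₀ : G} {z : E} (hz : z ∈ (extChartAt 𝓘(𝕜, E) g₀).target) :
    ContDiffAt 𝕜 ∞ (maurerCartanChart 𝕜 g₀) z := by
  rw [← contMDiffAt_iff_contDiffAt]
  refine contMDiffAt_modelDeriv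
    (f := fun z z' : E => ((extChartAt 𝓘(𝕜, E) g₀).symm z)⁻¹ * (extChartAt 𝓘(𝕜, E) g₀).symm z')
    (g := id) (y := 1) ?_ contMDiffAt_id (fun _ => rfl) (by simp)
  have h1 : ContMDiffAt (𝓘(𝕜, E).prod 𝓘(𝕜, E)) 𝓘(𝕜, E) ∞
      (fun p : E × E => (extChartAt 𝓘(𝕜, E) g₀).symm p.1) (z, z) :=
    (contMDiffAt_chart_symm hz).comp (z, z) contMDiffAt_fst
  have h2 : ContMDiffAt (𝓘(𝕜, E).prod 𝓘(𝕜, E)) 𝓘(𝕜, E) ∞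
      (fun p : E × E => (extChartAt 𝓘(𝕜, E) g₀).symm p.2) (z, z) :=
    (contMDiffAt_chart_symm hz).comp (z, z) contMDiffAt_snd
  exact h1.inv.mul h2

lemma maurerCartanChart_eq {g₀ : G} {z : E} (hz : z ∈ (extChartAt 𝓘(𝕜, E) g₀).target) :
    maurerCartanChart 𝕜 g₀ z = (maurerCartan 𝕜 E ((extChartAt 𝓘(𝕜, E) g₀).symm z)).comp
      (modelDeriv 𝕜 E E (extChartAt 𝓘(𝕜, E) g₀).symm z) :=
  modelDeriv_comp (mdifferentiableAt_mul_left _ _) (mdifferentiableAt_chart_symm hz) rfl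

lemma isInvertible_modelDeriv_chart_symm {g₀ : G} {z : E}
    (hz : z ∈ (extChartAt 𝓘(𝕜, E) g₀).target) :
    (modelDeriv 𝕜 E E (extChartAt 𝓘(𝕜, E) g₀).symm z).IsInvertible := by
  have : IsManifold 𝓘(𝕜, E) 1 G := .of_le (n := ∞) (by norm_cast)
  have := isInvertible_mfderivWithin_extChartAt_symm (I := 𝓘(𝕜, E)) (x := g₀) hz
  rwa [ModelWithCorners.range_eq_univ, mfderivWithin_univ] at this

/-- In a chart, the Maurer-Cartan form sends the left invariant vector field of `y` to `y`. -/
lemma maurerCartanChart_leftFieldChart {g₀ : G} {z : E}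
    (hz : z ∈ (extChartAt 𝓘(𝕜, E) g₀).target) (y : E) :
    maurerCartanChart 𝕜 g₀ z (leftFieldChart 𝕜 g₀ y z) = y := by
  rw [maurerCartanChart_eq hz, leftFieldChart_eq, ContinuousLinearMap.comp_apply,
    (isInvertible_modelDeriv_chart_symm hz).self_apply_inverse, maurerCartan_leftCLM]

lemma leftFieldChart_maurerCartanChart {g₀ : G} {z : E}
    (hz : z ∈ (extChartAt 𝓘(𝕜, E) g₀).target) (v : E) :
    leftFieldChart 𝕜 g₀ (maurerCartanChart 𝕜 g₀ z v) z = v := by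
  rw [maurerCartanChart_eq hz, leftFieldChart_eq, ContinuousLinearMap.comp_apply,
    leftCLM_maurerCartan, (isInvertible_modelDeriv_chart_symm hz).inverse_apply_self]

variable [CompleteSpace E]

/-- In a chart, left invariant vector fields bracket as the elements of the Lie algebra do. -/
lemma lieBracket_leftFieldChart {g₀ : G} {z : E}
    (hz : z ∈ (extChartAt 𝓘(𝕜, E) g₀).target) (x y : E) :
    DifferentiableAt 𝕜 (leftFieldChart 𝕜 g₀ x) z ∧
    lieBracket 𝕜 (leftFieldChart 𝕜 g₀ x) (leftFieldChart 𝕜 g₀ y) z =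
      leftFieldChart 𝕜 g₀ (modelBracket 𝕜 G x y) z := by
  have h3 : LieGroup 𝓘(𝕜, E) (minSmoothness 𝕜 3) G := by
    rw [minSmoothness_of_isRCLikeNormedField]; infer_instance
  have h2 : IsManifold 𝓘(𝕜, E) 2 G := .of_le (n := ∞) (by norm_cast)
  have h4 : IsManifold 𝓘(𝕜, E) (minSmoothness 𝕜 2) G := by
    rwa [minSmoothness_of_isRCLikeNormedField]
  have hinv := mdifferentiableAt_mulInvariantVectorField (I := 𝓘(𝕜, E)) (G := G)
    (g := (extChartAt 𝓘(𝕜, E) g₀).symm z)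
  have hσ : (mfderiv 𝓘(𝕜, E) 𝓘(𝕜, E) (extChartAt 𝓘(𝕜, E) g₀).symm z).IsInvertible :=
    isInvertible_modelDeriv_chart_symm (𝕜 := 𝕜) (E := E) (G := G) hz
  constructor
  · have := MDifferentiableAt.mpullback_vectorField (n := ∞) (hinv x)
      (contMDiffAt_chart_symm hz) hσ (by norm_cast)
    have h' : MDifferentiableAt 𝓘(𝕜, E) 𝓘(𝕜, E) (leftFieldChart 𝕜 g₀ x) z :=
      ((contMDiff_snd_tangentBundle_modelSpace E 𝓘(𝕜, E)).contMDiffAt.mdifferentiableAt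
        one_ne_zero).comp z this
    exact h'.differentiableAt
  · have h := mpullback_mlieBracket (n := ∞) (hinv x) (hinv y) (contMDiffAt_chart_symm hz)
      (by rw [minSmoothness_of_isRCLikeNormedField]; norm_cast)
    have hvec : ∀ V W : E → E, mlieBracket 𝓘(𝕜, E) V W z = lieBracket 𝕜 V W z := fun V W => by
      rw [← lieBracketWithin_univ]
      exact congrFun (mlieBracketWithin_eq_lieBracketWithin (V := V) (W := W) (s := Set.univ)) z
    have hleft := mulInvariantVector_mlieBracket (I := 𝓘(𝕜, E)) (G := G) x y
    rw [← hleft] at h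
    exact (hvec _ _).symm.trans h.symm

/-- The Maurer-Cartan equation. Differentiating the constant function `ω(L_y) = y`, for the left
invariant field `L_y` of `y`, expresses the derivative of `ω` through those of the fields `L_y`,
whose brackets are known. -/
lemma fderiv_maurerCartanChart_sub {g₀ : G} {z : E}
    (hz : z ∈ (extChartAt 𝓘(𝕜, E) g₀).target) (a b : E) :
    fderiv 𝕜 (maurerCartanChart 𝕜 g₀) z a b - fderiv 𝕜 (maurerCartanChart 𝕜 g₀) z b a =
      -modelBracket 𝕜 G (maurerCartanChart 𝕜 g₀ z a) (maurerCartanChart 𝕜 g₀ z b) := by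
  set A : E → E →L[𝕜] E := maurerCartanChart 𝕜 g₀
  -- The derivative of the constant function `z ↦ A z (L_y z)` in the direction `L_x z`.
  have key : ∀ x y : E, fderiv 𝕜 A z (leftFieldChart 𝕜 g₀ x z) (leftFieldChart 𝕜 g₀ y z) =
      -A z (fderiv 𝕜 (leftFieldChart 𝕜 g₀ y) z (leftFieldChart 𝕜 g₀ x z)) := by
    intro x y
    have hd := ((contDiffAt_maurerCartanChart hz).differentiableAt (by simp)).hasFDerivAt.clm_apply
      (lieBracket_leftFieldChart hz y y).1.hasFDerivAt
    have hc : (fun z => A z (leftFieldChart 𝕜 g₀ y z)) =ᶠ[𝓝 z] fun _ => y := by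
      filter_upwards [(isOpen_extChartAt_target g₀).mem_nhds hz] with z' hz'
      exact maurerCartanChart_leftFieldChart hz' y
    have := DFunLike.congr_fun (hd.unique ((hasFDerivAt_const y z).congr_of_eventuallyEq hc))
      (leftFieldChart 𝕜 g₀ x z)
    simp at this
    rw [eq_neg_iff_add_eq_zero, add_comm]
    exact this
  have := key (A z a) (A z b)
  have h' := key (A z b) (A z a)
  rw [leftFieldChart_maurerCartanChart hz, leftFieldChart_maurerCartanChart hz] at this h'
  rw [this, h', ← maurerCartanChart_leftFieldChart hz (modelBracket 𝕜 G (A z a) (A z b)),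
    ← (lieBracket_leftFieldChart hz _ _).2, lieBracket, leftFieldChart_maurerCartanChart hz,
    leftFieldChart_maurerCartanChart hz, map_sub]
  abel

/-! ### The differential of the adjoint action -/

/-- The differential of the adjoint action at the identity is the bracket. Writing `μ` for the
multiplication in the chart at the identity, both sides are differences of the mixed second
derivatives `D²μ (a, 0) (0, w)` and `D²μ (w, 0) (0, a)`. -/
lemma modelDeriv_adjointCLM_inv_one (a w : E) :
    modelDeriv 𝕜 E (E →L[𝕜] E) (fun g : G => adjointCLM 𝕜 E g⁻¹) 1 a w =
      -modelBracket 𝕜 G a w := by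
  have hM : IsManifold 𝓘(𝕜, E) 1 G := .of_le (n := ∞) (by norm_cast)
  set φ := extChartAt 𝓘(𝕜, E) (1 : G) with hφ
  set σ := φ.symm with hσ
  set z₀ := φ 1 with hz₀
  have hz₀T : z₀ ∈ φ.target := mem_extChartAt_target 1
  have hσz₀ : σ z₀ = 1 := extChartAt_to_inv 1
  have hTopen : IsOpen φ.target := isOpen_extChartAt_target 1
  have hSopen : IsOpen φ.source := isOpen_extChartAt_source 1
  have h1S : (1 : G) ∈ φ.source := mem_extChartAt_source 1
  have hφd : ∀ g ∈ φ.source, ContMDiffAt 𝓘(𝕜, E) 𝓘(𝕜, E) ∞ φ g := fun g hg =>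
    contMDiffAt_extChartAt' (by rwa [← extChartAt_source 𝓘(𝕜, E)])
  let μ : E × E → E := fun p => φ (σ p.1 * σ p.2)
  have hμ : ∀ z z', z ∈ φ.target → z' ∈ φ.target → σ z * σ z' ∈ φ.source →
      ContDiffAt 𝕜 ∞ μ (z, z') := by
    intro z z' hz hz' hs
    have h1 : ContMDiffAt (𝓘(𝕜, E).prod 𝓘(𝕜, E)) 𝓘(𝕜, E) ∞ (fun p : E × E => σ p.1) (z, z') :=
      (contMDiffAt_chart_symm hz).comp (z, z') contMDiffAt_fst
    have h2 : ContMDiffAt (𝓘(𝕜, E).prod 𝓘(𝕜, E)) 𝓘(𝕜, E) ∞ (fun p : E × E => σ p.2) (z, z') :=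
      (contMDiffAt_chart_symm hz').comp (z, z') contMDiffAt_snd
    have h3 : ContMDiffAt (𝓘(𝕜, E).prod 𝓘(𝕜, E)) 𝓘(𝕜, E) ∞ μ (z, z') :=
      (hφd _ hs).comp (z, z') (h1.mul h2)
    rw [← modelWithCornersSelf_prod, chartedSpaceSelf_prod] at h3
    exact contMDiffAt_iff_contDiffAt.1 h3
  have hμl : ∀ z ∈ φ.target, ContDiffAt 𝕜 ∞ μ (z, z₀) := fun z hz =>
    hμ z z₀ hz hz₀T (by rw [hσz₀, mul_one]; exact φ.map_target hz)
  have hμr : ∀ z ∈ φ.target, ContDiffAt 𝕜 ∞ μ (z₀, z) := fun z hz =>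
    hμ z₀ z hz₀T hz (by rw [hσz₀, one_mul]; exact φ.map_target hz)
  have hσd : ∀ z ∈ φ.target, MDifferentiableAt 𝓘(𝕜, E) 𝓘(𝕜, E) σ z := fun z hz =>
    mdifferentiableAt_chart_symm hz
  have hl : ∀ z ∈ φ.target, HasFDerivAt (fun z' => μ (z, z'))
      ((fderiv 𝕜 μ (z, z₀)).comp (ContinuousLinearMap.inr 𝕜 E E)) z₀ := fun z hz =>
    ((hμl z hz).differentiableAt (by simp)).hasFDerivAt.comp z₀ (hasFDerivAt_prodMk_right z z₀)
  have hr : ∀ z ∈ φ.target, HasFDerivAt (fun z' => μ (z', z))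
      ((fderiv 𝕜 μ (z₀, z)).comp (ContinuousLinearMap.inl 𝕜 E E)) z₀ := fun z hz =>
    HasFDerivAt.comp (f := fun z' => (z', z)) (g := μ) z₀
      ((hμr z hz).differentiableAt (by simp)).hasFDerivAt (hasFDerivAt_prodMk_left z₀ z)
  have hσ₀ : modelDeriv 𝕜 E E σ z₀ = ContinuousLinearMap.id 𝕜 E := modelDeriv_chart_symm 1
  let A : E → E →L[𝕜] E := maurerCartanChart 𝕜 (1 : G)
  let K : E → E →L[𝕜] E := fun z => adjointCLM 𝕜 E (σ z)⁻¹
  -- The chart expression of left translation inverts the Maurer-Cartan form.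
  have hA : ∀ z ∈ φ.target, ∀ w, A z (fderiv 𝕜 μ (z, z₀) (0, w)) = w := by
    intro z hz w
    have h := modelDeriv_comp (𝕜 := 𝕜) (E := E) (E' := E) (E'' := E) (f := fun z' => μ (z, z'))
      (g := fun z' : E => (σ z)⁻¹ * σ z') (x := z₀) (y := z)
      ((mdifferentiableAt_mul_left _ _).comp z (hσd z hz))
      (hl z hz).differentiableAt.mdifferentiableAt
      (by simp only [μ, hσz₀, mul_one]; exact φ.right_inv hz)
    have hev : (fun z' : E => (σ z)⁻¹ * σ z') ∘ (fun z' => μ (z, z')) =ᶠ[𝓝 z₀] σ := by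
      have hc : ContinuousAt (fun z' => σ z * σ z') z₀ :=
        ((mdifferentiableAt_mul_left (𝕜 := 𝕜) (E := E) _ _).comp z₀ (hσd z₀ hz₀T)).continuousAt
      have : σ z * σ z₀ ∈ φ.source := by rw [hσz₀, mul_one]; exact φ.map_target hz
      filter_upwards [hc.preimage_mem_nhds (hSopen.mem_nhds this)] with z' hz'
      simp only [Function.comp, μ]
      rw [hσ, φ.left_inv hz', inv_mul_cancel_left]
    rw [modelDeriv_congr hev, hσ₀, modelDeriv_eq_fderiv (fun z' => μ (z, z')),
      (hl z hz).fderiv] at h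
    have h' := (DFunLike.congr_fun h w).symm
    simp only [ContinuousLinearMap.comp_apply, ContinuousLinearMap.inr_apply,
      ContinuousLinearMap.id_apply] at h'
    exact h'
  -- Right translation is left translation composed with the adjoint action.
  have hK : ∀ z ∈ φ.target, ∀ w,
      fderiv 𝕜 μ (z₀, z) (w, 0) = fderiv 𝕜 μ (z, z₀) (0, K z w) := by
    intro z hz w
    let c : E → E := fun z' => φ ((σ z)⁻¹ * σ z' * (σ z)⁻¹⁻¹)
    have hc₁ : (σ z)⁻¹ * σ z₀ * (σ z)⁻¹⁻¹ = 1 := by simp [hσz₀]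
    have hconj : MDifferentiableAt 𝓘(𝕜, E) 𝓘(𝕜, E)
        ((fun k : G => (σ z)⁻¹ * k * (σ z)⁻¹⁻¹) ∘ σ) z₀ :=
      (mdifferentiableAt_conj _ _).comp z₀ (hσd z₀ hz₀T)
    have hφ₁ : MDifferentiableAt 𝓘(𝕜, E) 𝓘(𝕜, E) φ (1 : G) :=
      (hφd 1 h1S).mdifferentiableAt (by simp)
    have hcd : modelDeriv 𝕜 E E c z₀ = K z := by
      have h := modelDeriv_comp (f := (fun k : G => (σ z)⁻¹ * k * (σ z)⁻¹⁻¹) ∘ σ) hφ₁ hconj hc₁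
      rw [modelDeriv_comp (mdifferentiableAt_conj _ _) (hσd z₀ hz₀T) hσz₀, hσ₀,
        modelDeriv_chart] at h
      exact h
    have hc₀ : c z₀ = z₀ := by simp only [c, hc₁]; rfl
    have hcm : MDifferentiableAt 𝓘(𝕜, E) 𝓘(𝕜, E) c z₀ :=
      MDifferentiableAt.comp_of_eq (I' := 𝓘(𝕜, E)) z₀ hφ₁ hconj hc₁
    have h := modelDeriv_comp (𝕜 := 𝕜) (E := E) (E' := E) (E'' := E) (f := c)
      (g := fun z' => μ (z, z')) (x := z₀) (y := z₀)
      (hl z hz).differentiableAt.mdifferentiableAt hcm hc₀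
    have hev : (fun z' => μ (z, z')) ∘ c =ᶠ[𝓝 z₀] fun z' => μ (z', z) := by
      have : (σ z)⁻¹ * σ z₀ * (σ z)⁻¹⁻¹ ∈ φ.source := by rwa [hc₁]
      filter_upwards [hconj.continuousAt.preimage_mem_nhds (hSopen.mem_nhds this)] with z' hz'
      simp only [Function.comp, μ, c]
      rw [show σ (φ ((σ z)⁻¹ * σ z' * (σ z)⁻¹⁻¹)) = _ from φ.left_inv hz']
      simp [mul_assoc]
    rw [modelDeriv_congr hev, hcd, modelDeriv_eq_fderiv, (hr z hz).fderiv,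
      modelDeriv_eq_fderiv (fun z' => μ (z, z')), (hl z hz).fderiv] at h
    simpa using DFunLike.congr_fun h w
  have hA₀ : A z₀ = ContinuousLinearMap.id 𝕜 E := by
    have h : A z₀ = modelDeriv 𝕜 E E (fun z' => (σ z₀)⁻¹ * σ z') z₀ := rfl
    simpa [hσz₀, hσ₀] using h
  have hK₀ : K z₀ = ContinuousLinearMap.id 𝕜 E := by
    simp only [K, hσz₀, inv_one, adjointCLM_one]
  have hμ₀ : ∀ w, fderiv 𝕜 μ (z₀, z₀) (0, w) = w := fun w => by
    simpa [hA₀] using hA z₀ hz₀T w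
  have hsymm : IsSymmSndFDerivAt 𝕜 μ (z₀, z₀) :=
    (hμl z₀ hz₀T).isSymmSndFDerivAt (by
      rw [minSmoothness_of_isRCLikeNormedField]; norm_cast)
  have hD : HasFDerivAt (fderiv 𝕜 μ) (fderiv 𝕜 (fderiv 𝕜 μ) (z₀, z₀)) (z₀, z₀) :=
    (((hμl z₀ hz₀T).fderiv_right (m := 1) (by norm_cast)).differentiableAt
      (by simp)).hasFDerivAt
  set D := fderiv 𝕜 (fderiv 𝕜 μ) (z₀, z₀)
  have hDl : HasFDerivAt (fun z => fderiv 𝕜 μ (z, z₀)) (D.comp (.inl 𝕜 E E)) z₀ :=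
    HasFDerivAt.comp (f := fun z => (z, z₀)) z₀ hD (hasFDerivAt_prodMk_left z₀ z₀)
  have hDr : HasFDerivAt (fun z => fderiv 𝕜 μ (z₀, z)) (D.comp (.inr 𝕜 E E)) z₀ :=
    hD.comp z₀ (hasFDerivAt_prodMk_right z₀ z₀)
  have hAd : HasFDerivAt A (fderiv 𝕜 A z₀) z₀ :=
    ((contDiffAt_maurerCartanChart hz₀T).differentiableAt (by simp)).hasFDerivAt
  have hKm : MDifferentiableAt 𝓘(𝕜, E) 𝓘(𝕜, E →L[𝕜] E)
      (fun g : G => adjointCLM 𝕜 E g⁻¹) 1 :=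
    contMDiff_adjointCLM_inv.mdifferentiableAt (by simp)
  have hKd : HasFDerivAt K
      (modelDeriv 𝕜 E (E →L[𝕜] E) (fun g : G => adjointCLM 𝕜 E g⁻¹) 1) z₀ := by
    have h := modelDeriv_comp hKm (hσd z₀ hz₀T) hσz₀
    rw [hσ₀, modelDeriv_eq_fderiv, ContinuousLinearMap.comp_id] at h
    rw [← h]
    have : MDifferentiableAt 𝓘(𝕜, E) 𝓘(𝕜, E →L[𝕜] E) K z₀ :=
      MDifferentiableAt.comp_of_eq (I' := 𝓘(𝕜, E)) z₀ hKm (hσd z₀ hz₀T) hσz₀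
    exact this.differentiableAt.hasFDerivAt
  have hDA : ∀ a w, fderiv 𝕜 A z₀ a w = -D (a, 0) (0, w) := by
    intro a w
    have h1 := hAd.clm_apply (hDl.clm_apply (hasFDerivAt_const ((0 : E), w) z₀))
    have h2 : (fun z => A z (fderiv 𝕜 μ (z, z₀) (0, w))) =ᶠ[𝓝 z₀] fun _ => w := by
      filter_upwards [hTopen.mem_nhds hz₀T] with z hz using hA z hz w
    have h3 := DFunLike.congr_fun
      (h1.unique ((hasFDerivAt_const w z₀).congr_of_eventuallyEq h2)) a
    simp [hμ₀, hA₀] at h3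
    rw [eq_neg_iff_add_eq_zero, add_comm]
    exact h3
  have hDK : ∀ a w, D (0, a) (w, 0) = D (a, 0) (0, w) +
      modelDeriv 𝕜 E (E →L[𝕜] E) (fun g : G => adjointCLM 𝕜 E g⁻¹) 1 a w := by
    intro a w
    have h1 := hDr.clm_apply (hasFDerivAt_const (w, (0 : E)) z₀)
    have h2 := hDl.clm_apply ((ContinuousLinearMap.inr 𝕜 E E).hasFDerivAt.comp z₀
      (hKd.clm_apply (hasFDerivAt_const w z₀)))
    have h3 : (fun z => fderiv 𝕜 μ (z₀, z) (w, 0)) =ᶠ[𝓝 z₀]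
        fun z => fderiv 𝕜 μ (z, z₀) (ContinuousLinearMap.inr 𝕜 E E (K z w)) := by
      filter_upwards [hTopen.mem_nhds hz₀T] with z hz using hK z hz w
    have h4 := DFunLike.congr_fun (h1.unique (h2.congr_of_eventuallyEq h3)) a
    simp [hμ₀, hK₀] at h4
    rw [h4, add_comm]
  have hMC := fderiv_maurerCartanChart_sub (𝕜 := 𝕜) (g₀ := (1 : G)) hz₀T a w
  change fderiv 𝕜 A z₀ a w - fderiv 𝕜 A z₀ w a = -modelBracket 𝕜 G (A z₀ a) (A z₀ w) at hMC
  rw [hA₀, hDA, hDA] at hMC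
  have h5 := hDK a w
  rw [show D (0, a) (w, 0) = D (w, 0) (0, a) from hsymm _ _] at h5
  simp only [ContinuousLinearMap.id_apply] at hMC
  rw [← hMC, h5]
  abel

end LieGroups

/-! ### The closed forms attached to a 2-cocycle of the Lie algebra -/

section Cocycles

open Filter Topology

variable {𝕜 : Type*} [RCLike 𝕜] {E : Type*} [NormedAddCommGroup E] [NormedSpace 𝕜 E]
  {G : Type*} [TopologicalSpace G] [ChartedSpace E G]

lemma modelDeriv_neg_apply (f : G → 𝕜) (g : G) (v : E) :
    modelDeriv 𝕜 E 𝕜 (fun m => -f m) g v = -modelDeriv 𝕜 E 𝕜 f g v := by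
  have h : modelDeriv 𝕜 E 𝕜 (fun m => -f m) g = -modelDeriv 𝕜 E 𝕜 f g := mfderiv_neg
  rw [h, neg_apply]

lemma modelDeriv_const_sub_apply (c : 𝕜) {f : G → 𝕜} {g : G}
    (hf : MDifferentiableAt 𝓘(𝕜, E) 𝓘(𝕜, 𝕜) f g) (v : E) :
    modelDeriv 𝕜 E 𝕜 (fun m => c - f m) g v = -modelDeriv 𝕜 E 𝕜 f g v := by
  have hc : HasFDerivAt (fun t : 𝕜 => c - t) (-ContinuousLinearMap.id 𝕜 𝕜) (f g) :=
    (hasFDerivAt_id _).const_sub c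
  have h := modelDeriv_comp hc.differentiableAt.mdifferentiableAt hf rfl
  rw [modelDeriv_eq_fderiv, hc.fderiv] at h
  exact (DFunLike.congr_fun h v).trans (by simp)

lemma modelDeriv_clm_sub_const_apply (ξ : E →L[𝕜] 𝕜) {f : G → E} {g : G}
    (hf : MDifferentiableAt 𝓘(𝕜, E) 𝓘(𝕜, E) f g) (c : 𝕜) (v : E) :
    modelDeriv 𝕜 E 𝕜 (fun m => ξ (f m) - c) g v = ξ (modelDeriv 𝕜 E E f g v) := by
  have hc : HasFDerivAt (fun x => ξ x - c) ξ (f g) := ξ.hasFDerivAt.sub_const c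
  have h := modelDeriv_comp hc.differentiableAt.mdifferentiableAt hf rfl
  rw [modelDeriv_eq_fderiv, hc.fderiv] at h
  exact DFunLike.congr_fun h v

variable [Group G]

lemma maurerCartan_one : maurerCartan 𝕜 E (1 : G) = ContinuousLinearMap.id 𝕜 E := by
  have h : (fun k : G => (1 : G)⁻¹ * k) = id := by ext; simp
  rw [maurerCartan, h, modelDeriv_id]

variable [LieGroup 𝓘(𝕜, E) ∞ G]

/-- The Maurer-Cartan form is left invariant. -/
lemma maurerCartan_mul (g h : G) :
    (maurerCartan 𝕜 E (g * h)).comp (modelDeriv 𝕜 E E (fun k : G => g * k) h) =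
      maurerCartan 𝕜 E h := by
  have := modelDeriv_comp (mdifferentiableAt_mul_left (𝕜 := 𝕜) (E := E) (g * h)⁻¹ (g * h))
    (mdifferentiableAt_mul_left (𝕜 := 𝕜) (E := E) g h) rfl
  have h' : (fun k : G => (g * h)⁻¹ * k) ∘ (fun k : G => g * k) = fun k => h⁻¹ * k := by
    ext; simp [mul_assoc]
  rw [h'] at this
  exact this.symm

lemma contMDiff_adjointCLM_inv_apply (w : E) :
    ContMDiff 𝓘(𝕜, E) 𝓘(𝕜, E) ∞ (fun g : G => adjointCLM 𝕜 E g⁻¹ w) :=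
  contMDiff_adjointCLM_inv.clm_apply contMDiff_const

/-- The differential of `g ↦ Ad_{g⁻¹} w`: by the multiplicativity of `Ad`, it is determined by the
differential at the identity. -/
lemma modelDeriv_adjointCLM_inv [CompleteSpace E] (w v : E) (g : G) :
    modelDeriv 𝕜 E E (fun h : G => adjointCLM 𝕜 E h⁻¹ w) g v =
      -modelBracket 𝕜 G (maurerCartan 𝕜 E g v) (adjointCLM 𝕜 E g⁻¹ w) := by
  have hK : MDifferentiableAt 𝓘(𝕜, E) 𝓘(𝕜, E →L[𝕜] E)
      (fun g : G => adjointCLM 𝕜 E g⁻¹) 1 :=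
    contMDiff_adjointCLM_inv.mdifferentiableAt (by simp)
  let ev : (E →L[𝕜] E) →L[𝕜] E := ContinuousLinearMap.apply 𝕜 E (adjointCLM 𝕜 E g⁻¹ w)
  have h1 := modelDeriv_comp (g := fun g : G => adjointCLM 𝕜 E g⁻¹) hK
    (mdifferentiableAt_mul_left (𝕜 := 𝕜) (E := E) g⁻¹ g) (inv_mul_cancel g)
  have h2 := modelDeriv_comp (𝕜 := 𝕜) (g := ev)
    (f := (fun g : G => adjointCLM 𝕜 E g⁻¹) ∘ fun h : G => g⁻¹ * h) (x := g)
    ev.differentiableAt.mdifferentiableAt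
    (MDifferentiableAt.comp_of_eq (I' := 𝓘(𝕜, E)) g hK
      (mdifferentiableAt_mul_left (𝕜 := 𝕜) (E := E) g⁻¹ g) (inv_mul_cancel g)) rfl
  have h3 : ev ∘ ((fun g : G => adjointCLM 𝕜 E g⁻¹) ∘ fun h : G => g⁻¹ * h) =
      fun h : G => adjointCLM 𝕜 E h⁻¹ w := by
    ext h
    change adjointCLM 𝕜 E (g⁻¹ * h)⁻¹ (adjointCLM 𝕜 E g⁻¹ w) = _
    rw [← ContinuousLinearMap.comp_apply, ← adjointCLM_mul]
    simp
  rw [h3, h1, modelDeriv_eq_fderiv, ev.fderiv] at h2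
  rw [h2, ← modelDeriv_adjointCLM_inv_one]
  rfl

/-- Let `Γ` be a 2-cocycle on the Lie algebra. The 1-form with the value
`v ↦ Γ (v, Ad_{g⁻¹} w)` at `g`, in the left trivialization, has local primitives: by the
Maurer-Cartan equation and the cocycle identity it is closed. -/
lemma exists_local_primitive [CompleteSpace E] (Γ : E →L[𝕜] E →L[𝕜] 𝕜)
    (hskew : ∀ x y, Γ x y = -Γ y x)
    (hΓ : ∀ x y z, Γ x (modelBracket 𝕜 G y z) - Γ y (modelBracket 𝕜 G x z) +
      Γ z (modelBracket 𝕜 G x y) = 0) (w : E) (g₀ : G) :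
    ∃ U : Set G, IsOpen U ∧ g₀ ∈ U ∧ ∃ f : G → 𝕜, ∀ g ∈ U,
      HasMFDerivAt 𝓘(𝕜, E) 𝓘(𝕜, 𝕜) f g
        ((Γ.flip (adjointCLM 𝕜 E g⁻¹ w)).comp (maurerCartan 𝕜 E g)) ∧
      ContMDiffAt 𝓘(𝕜, E) 𝓘(𝕜, 𝕜) ∞ f g := by
  let _ : NormedSpace ℝ E := NormedSpace.restrictScalars ℝ 𝕜 E
  set φ := extChartAt 𝓘(𝕜, E) g₀ with hφ
  let A : E → E →L[𝕜] E := maurerCartanChart 𝕜 g₀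
  let κ : E → E := fun z => adjointCLM 𝕜 E (φ.symm z)⁻¹ w
  let Ω : E → E →L[𝕜] 𝕜 := fun z => (Γ.flip (κ z)).comp (A z)
  have hκ : ∀ z ∈ φ.target, ContDiffAt 𝕜 ∞ κ z := fun z hz =>
    contMDiffAt_iff_contDiffAt.1 <|
      (contMDiff_adjointCLM_inv_apply w).contMDiffAt.comp z (contMDiffAt_chart_symm hz)
  have hκ' : ∀ z ∈ φ.target, ∀ a, fderiv 𝕜 κ z a = -modelBracket 𝕜 G (A z a) (κ z) := by
    intro z hz a
    have h := modelDeriv_comp (g := fun g : G => adjointCLM 𝕜 E g⁻¹ w)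
      ((contMDiff_adjointCLM_inv_apply (𝕜 := 𝕜) (G := G) w).mdifferentiableAt (by simp))
      (mdifferentiableAt_chart_symm hz) rfl
    rw [modelDeriv_eq_fderiv] at h
    refine (DFunLike.congr_fun h a).trans ?_
    rw [ContinuousLinearMap.comp_apply, modelDeriv_adjointCLM_inv,
      ← ContinuousLinearMap.comp_apply (maurerCartan 𝕜 E _), ← maurerCartanChart_eq hz]
  have hA : ∀ z ∈ φ.target, ContDiffAt 𝕜 ∞ A z := fun z hz => contDiffAt_maurerCartanChart hz
  have hΩ : ∀ z ∈ φ.target, ContDiffAt 𝕜 ∞ Ω z := fun z hz =>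
    (Γ.flip.contDiff.contDiffAt.comp z (hκ z hz)).clm_comp (hA z hz)
  have hΩ' : ∀ z ∈ φ.target, ∀ a b, fderiv 𝕜 Ω z a b = fderiv 𝕜 Ω z b a := by
    intro z hz
    have hform : ∀ a b, fderiv 𝕜 Ω z a b =
        -Γ (A z b) (modelBracket 𝕜 G (A z a) (κ z)) + Γ (fderiv 𝕜 A z a b) (κ z) := by
      intro a b
      have h := (Γ.flip.hasFDerivAt.comp z
        ((hκ z hz).differentiableAt (by simp)).hasFDerivAt).clm_comp
        ((hA z hz).differentiableAt (by simp)).hasFDerivAt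
      rw [show fderiv 𝕜 Ω z = _ from h.fderiv]
      simp [hκ' z hz, add_comm]
    intro a b
    have hMC : fderiv 𝕜 A z a b - fderiv 𝕜 A z b a = -modelBracket 𝕜 G (A z a) (A z b) :=
      fderiv_maurerCartanChart_sub hz a b
    -- The antisymmetrized derivative is the cocycle identity for `A z a`, `A z b` and `κ z`.
    rw [hform, hform, sub_eq_iff_eq_add.1 hMC, map_add, map_neg, add_apply,
      neg_apply]
    have h1 := hΓ (A z a) (A z b) (κ z)
    rw [hskew (κ z)] at h1
    linear_combination h1
  obtain ⟨ε, hε, hball⟩ := Metric.isOpen_iff.1 (isOpen_extChartAt_target (I := 𝓘(𝕜, E)) g₀) (φ g₀)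
    (mem_extChartAt_target g₀)
  obtain ⟨h, hh⟩ : ∃ h : E → 𝕜, ∀ z ∈ Metric.ball (φ g₀) ε,
      HasFDerivWithinAt h (Ω z) (Metric.ball (φ g₀) ε) z :=
    (convex_ball (φ g₀) ε).exists_forall_hasFDerivWithinAt_of_hasFDerivWithinAt_symmetric
      (fun z hz => (((hΩ z (hball hz)).differentiableAt (by simp)).hasFDerivAt.restrictScalars
        ℝ).hasFDerivWithinAt)
      (fun z hz a _ b _ => hΩ' z (hball hz) a b)
  have hh' : ∀ z ∈ Metric.ball (φ g₀) ε, HasFDerivAt h (Ω z) z := fun z hz =>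
    (hh z hz).hasFDerivAt (Metric.isOpen_ball.mem_nhds hz)
  have hhsmooth : ContDiffOn 𝕜 ∞ h (Metric.ball (φ g₀) ε) := by
    rw [contDiffOn_infty_iff_fderiv_of_isOpen Metric.isOpen_ball]
    refine ⟨fun z hz => (hh' z hz).differentiableAt.differentiableWithinAt, ?_⟩
    exact ContDiffOn.congr (fun z hz => (hΩ z (hball hz)).contDiffWithinAt)
      fun z hz => (hh' z hz).fderiv
  refine ⟨φ.source ∩ φ ⁻¹' Metric.ball (φ g₀) ε,
    (continuousOn_extChartAt g₀).isOpen_inter_preimage (isOpen_extChartAt_source g₀)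
      Metric.isOpen_ball, ⟨mem_extChartAt_source g₀, Metric.mem_ball_self hε⟩, h ∘ φ, ?_⟩
  rintro g ⟨hg, hgb⟩
  have hφd : ContMDiffAt 𝓘(𝕜, E) 𝓘(𝕜, E) ∞ φ g :=
    contMDiffAt_extChartAt' (by rwa [← extChartAt_source 𝓘(𝕜, E)])
  have hh₁ : MDifferentiableAt 𝓘(𝕜, E) 𝓘(𝕜, 𝕜) h (φ g) :=
    (hh' _ hgb).differentiableAt.mdifferentiableAt
  have hφ₁ : MDifferentiableAt 𝓘(𝕜, E) 𝓘(𝕜, E) φ g := hφd.mdifferentiableAt (by simp)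
  constructor
  · have hd : MDifferentiableAt 𝓘(𝕜, E) 𝓘(𝕜, 𝕜) (h ∘ φ) g := hh₁.comp g hφ₁
    have hgT : φ g ∈ φ.target := φ.map_source hg
    have hinv : φ.symm (φ g) = g := φ.left_inv hg
    have e1 : modelDeriv 𝕜 E 𝕜 (h ∘ φ) g =
        (Ω (φ g)).comp (modelDeriv 𝕜 E E φ g) := by
      rw [modelDeriv_comp hh₁ hφ₁ rfl, modelDeriv_eq_fderiv, (hh' _ hgb).fderiv]
    have e2 : (modelDeriv 𝕜 E E φ.symm (φ g)).comp (modelDeriv 𝕜 E E φ g) =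
        ContinuousLinearMap.id 𝕜 E := by
      rw [← modelDeriv_comp (mdifferentiableAt_chart_symm hgT) hφ₁ rfl, ← modelDeriv_id g]
      refine modelDeriv_congr ?_
      filter_upwards [(isOpen_extChartAt_source (I := 𝓘(𝕜, E)) g₀).mem_nhds hg] with k hk
      exact φ.left_inv hk
    have e3 : modelDeriv 𝕜 E 𝕜 (h ∘ φ) g =
        (Γ.flip (adjointCLM 𝕜 E g⁻¹ w)).comp (maurerCartan 𝕜 E g) := by
      rw [e1]
      simp only [Ω, κ, A]
      rw [maurerCartanChart_eq hgT, ContinuousLinearMap.comp_assoc,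
        ContinuousLinearMap.comp_assoc, e2, ContinuousLinearMap.comp_id, ← hφ, hinv]
    exact hd.hasMFDerivAt.congr_mfderiv e3
  · exact ((contMDiffAt_iff_contDiffAt.2 (hhsmooth.contDiffAt
      (Metric.isOpen_ball.mem_nhds hgb))).comp g hφd)

/-- On a simply connected group, the closed 1-forms of `exists_local_primitive` have global
primitives vanishing at the identity. They depend linearly on the parameter, because a primitive is
unique up to a constant. -/
lemma exists_modelDeriv_eq [CompleteSpace E] [SimplyConnectedSpace G] (Γ : E →L[𝕜] E →L[𝕜] 𝕜)
    (hskew : ∀ x y, Γ x y = -Γ y x)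
    (hΓ : ∀ x y z, Γ x (modelBracket 𝕜 G y z) - Γ y (modelBracket 𝕜 G x z) +
      Γ z (modelBracket 𝕜 G x y) = 0) :
    ∃ B : G → E →ₗ[𝕜] 𝕜, (∀ x, ContMDiff 𝓘(𝕜, E) 𝓘(𝕜, 𝕜) ∞ fun g => B g x) ∧ B 1 = 0 ∧
      ∀ x g v, modelDeriv 𝕜 E 𝕜 (fun m => B m x) g v =
        Γ (maurerCartan 𝕜 E g v) (adjointCLM 𝕜 E g⁻¹ x) := by
  have hprim := fun w => exists_primitive_of_locally_exact
    (fun g : G => (Γ.flip (adjointCLM 𝕜 E g⁻¹ w)).comp (maurerCartan 𝕜 E g))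
    (exists_local_primitive Γ hskew hΓ w)
  choose f hsmooth hf using hprim
  have hadd : ∀ x y g, f (x + y) g - (f x g + f y g) = f (x + y) 1 - (f x 1 + f y 1) := by
    intro x y g
    refine eq_of_hasMFDerivAt_zero (𝕜 := 𝕜) (E := E)
      (f := fun g => f (x + y) g - (f x g + f y g)) (fun g => ?_) g 1
    refine ((hf (x + y) g).sub ((hf x g).add (hf y g))).congr_mfderiv (sub_eq_zero.2 ?_)
    ext v
    exact (congrArg (Γ (maurerCartan 𝕜 E g v)) (map_add _ x y)).trans (map_add _ _ _)
  have hsmul : ∀ (c : 𝕜) x g, f (c • x) g - c • f x g = f (c • x) 1 - c • f x 1 := by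
    intro c x g
    refine eq_of_hasMFDerivAt_zero (𝕜 := 𝕜) (E := E)
      (f := fun g => f (c • x) g - c • f x g) (fun g => ?_) g 1
    refine ((hf (c • x) g).sub ((hf x g).const_smul c)).congr_mfderiv (sub_eq_zero.2 ?_)
    ext v
    exact (congrArg (Γ (maurerCartan 𝕜 E g v)) (map_smul _ c x)).trans (map_smul _ _ _)
  refine ⟨fun g =>
    { toFun := fun x => f x g - f x 1
      map_add' := fun x y => by linear_combination hadd x y g
      map_smul' := fun c x => by
        have := hsmul c x g
        simp only [smul_eq_mul, RingHom.id_apply] at this ⊢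
        linear_combination this }, fun x => (hsmooth x).sub contMDiff_const, ?_, fun x g v => ?_⟩
  · ext x
    simp
  · have h : HasMFDerivAt 𝓘(𝕜, E) 𝓘(𝕜, 𝕜) (fun g => f x g - f x 1) g _ :=
      (hf x g).sub (hasMFDerivAt_const (I := 𝓘(𝕜, E)) (I' := 𝓘(𝕜, 𝕜)) (f x 1) g)
    refine (DFunLike.congr_fun h.mfderiv v).trans ?_
    exact sub_zero _

end Cocycles

/-! ### Moment maps and group cocycles -/

section MomentMaps

variable {𝕜 : Type*} [RCLike 𝕜] {E : Type*} [NormedAddCommGroup E] [NormedSpace 𝕜 E]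
  {G : Type*} [TopologicalSpace G] [ChartedSpace E G] [Group G]

lemma mdifferentiableAt_of_isSmoothToDual {B : G → Module.Dual 𝕜 (GroupLieAlgebra 𝓘(𝕜, E) G)}
    (hB : IsSmoothToDual (F := E) B) (x : GroupLieAlgebra 𝓘(𝕜, E) G) (g : G) :
    MDifferentiableAt 𝓘(𝕜, E) 𝓘(𝕜, 𝕜) (fun g => B g x) g :=
  (hB x).mdifferentiableAt (by simp)

lemma hasDifferentialAtOne_of_modelDeriv
    {B : G → Module.Dual 𝕜 (GroupLieAlgebra 𝓘(𝕜, E) G)}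
    {γ : GroupLieAlgebra 𝓘(𝕜, E) G →ₗ[𝕜] Module.Dual 𝕜 (GroupLieAlgebra 𝓘(𝕜, E) G)}
    (hB : ∀ (x : GroupLieAlgebra 𝓘(𝕜, E) G) (g : G) (v : E),
      modelDeriv 𝕜 E 𝕜 (fun m => B m x) g v = γ (maurerCartan 𝕜 E g v) (adjoint g⁻¹ x)) :
    HasDifferentialAtOne B γ := by
  intro x y
  refine (hB y 1 x).trans ?_
  simp only [maurerCartan_one, inv_one]
  change γ x (adjointCLM 𝕜 E (1 : G) y) = _
  rw [adjointCLM_one]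
  rfl

variable [LieGroup 𝓘(𝕜, E) ∞ G]

lemma adjoint_mul (g h : G) (x : GroupLieAlgebra 𝓘(𝕜, E) G) :
    adjoint (g * h) x = adjoint g (adjoint h x) :=
  DFunLike.congr_fun (adjointCLM_mul (𝕜 := 𝕜) (E := E) g h) x

/-- The vector field induced by left translations is right invariant; in the left trivialization it
is `g ↦ Ad_{g⁻¹} x`. -/
lemma inducedVectorField_eq (x : GroupLieAlgebra 𝓘(𝕜, E) G) (g : G) :
    inducedVectorField (F := E) x g = leftTranslation g (adjoint g⁻¹ x) :=
  DFunLike.congr_fun (modelDeriv_mul_right (𝕜 := 𝕜) (E := E) g) x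

/-- The differential of a group cocycle is determined by its differential at the identity, since
`B(m) = B(g) + Ad*_g B(g⁻¹m)`. -/
lemma modelDeriv_of_isGroupCocycle {B : G → Module.Dual 𝕜 (GroupLieAlgebra 𝓘(𝕜, E) G)}
    {γ : GroupLieAlgebra 𝓘(𝕜, E) G →ₗ[𝕜] Module.Dual 𝕜 (GroupLieAlgebra 𝓘(𝕜, E) G)}
    (hB : IsGroupCocycle B) (hγ : HasDifferentialAtOne B γ) (x : GroupLieAlgebra 𝓘(𝕜, E) G)
    (g : G) (v : E) :
    modelDeriv 𝕜 E 𝕜 (fun m => B m x) g v =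
      γ (maurerCartan 𝕜 E g v) (adjoint g⁻¹ x) := by
  have h1 : (fun m => B m x) = (fun c : 𝕜 => B g x + c) ∘
      ((fun m => B m (adjoint g⁻¹ x)) ∘ fun m => g⁻¹ * m) := by
    ext m
    simp only [Function.comp, ← hB.2 g (g⁻¹ * m) x, mul_inv_cancel_left]
  have hd := mdifferentiableAt_of_isSmoothToDual hB.1 (adjoint g⁻¹ x) 1
  have hl := mdifferentiableAt_mul_left (𝕜 := 𝕜) (E := E) g⁻¹ g
  have ha : HasFDerivAt (fun c : 𝕜 => B g x + c) (ContinuousLinearMap.id 𝕜 𝕜)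
      (B (g⁻¹ * g) (adjoint g⁻¹ x)) := (hasFDerivAt_id _).const_add _
  rw [h1, modelDeriv_comp ha.differentiableAt.mdifferentiableAt
    (MDifferentiableAt.comp_of_eq (I' := 𝓘(𝕜, E)) g hd hl (inv_mul_cancel g)) rfl,
    modelDeriv_comp hd hl (inv_mul_cancel g), modelDeriv_eq_fderiv, ha.fderiv]
  exact hγ (maurerCartan 𝕜 E g v) (adjoint g⁻¹ x)

/-- On a connected group, a map vanishing at the identity whose differential is that of a cocycle
is a cocycle: the difference of the two sides of the cocycle identity has zero differential. -/
lemma isGroupCocycle_of_modelDeriv [ConnectedSpace G]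
    {B : G → Module.Dual 𝕜 (GroupLieAlgebra 𝓘(𝕜, E) G)}
    {γ : GroupLieAlgebra 𝓘(𝕜, E) G →ₗ[𝕜] Module.Dual 𝕜 (GroupLieAlgebra 𝓘(𝕜, E) G)}
    (hsmooth : IsSmoothToDual (F := E) B) (hone : B 1 = 0)
    (hB : ∀ (x : GroupLieAlgebra 𝓘(𝕜, E) G) (g : G) (v : E),
      modelDeriv 𝕜 E 𝕜 (fun m => B m x) g v = γ (maurerCartan 𝕜 E g v) (adjoint g⁻¹ x)) :
    IsGroupCocycle B := by
  refine ⟨hsmooth, fun g h x => ?_⟩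
  have hd : ∀ k : G, HasMFDerivAt 𝓘(𝕜, E) 𝓘(𝕜, 𝕜)
      (fun k => B (g * k) x - B k (adjoint g⁻¹ x)) k 0 := by
    intro k
    have hx := mdifferentiableAt_of_isSmoothToDual hsmooth x (g * k)
    have hy := mdifferentiableAt_of_isSmoothToDual hsmooth (adjoint g⁻¹ x) k
    have hl := mdifferentiableAt_mul_left (𝕜 := 𝕜) (E := E) g k
    have h1 := (hx.comp k hl).hasMFDerivAt.sub hy.hasMFDerivAt
    have h2 : modelDeriv 𝕜 E 𝕜 ((fun m => B m x) ∘ fun k => g * k) k =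
        modelDeriv 𝕜 E 𝕜 (fun m => B m (adjoint g⁻¹ x)) k := by
      ext v
      rw [modelDeriv_comp hx hl rfl, ContinuousLinearMap.comp_apply, hB, hB,
        ← ContinuousLinearMap.comp_apply (maurerCartan 𝕜 E _), maurerCartan_mul]
      congr 1
      rw [mul_inv_rev, adjoint_mul]
    exact h1.congr_mfderiv (sub_eq_zero.2 h2)
  have := eq_of_hasMFDerivAt_zero hd h 1
  simp only [mul_one, hone, LinearMap.zero_apply, sub_zero] at this
  rw [← this]
  abel

variable [FiniteDimensional 𝕜 E]

/-- In the left trivialization of the tangent bundle, the moment map equation says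
`dJ*(x) = ř⁻¹(Ad_{g⁻¹} x)`. -/
lemma isMomentMap_iff {r : GroupLieAlgebra 𝓘(𝕜, E) G ⊗[𝕜] GroupLieAlgebra 𝓘(𝕜, E) G}
    (h : IsNondegenerate r) (J : G → Module.Dual 𝕜 (GroupLieAlgebra 𝓘(𝕜, E) G)) :
    IsMomentMap (leftInvariantBivector r) J ↔ IsSmoothToDual (F := E) J ∧
      ∀ (x : GroupLieAlgebra 𝓘(𝕜, E) G) (g : G) (v : E),
        modelDeriv 𝕜 E 𝕜 (fun m => J m x) g v =
          rCheckInv r h (adjoint g⁻¹ x) (maurerCartan 𝕜 E g v) := by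
  refine and_congr_right fun _ => forall_congr' fun x => forall_congr' fun g => ?_
  rw [inducedVectorField_eq]
  exact contract_map_eq_iff h (leftTranslation g) (fun v => maurerCartan 𝕜 E g v)
    (maurerCartan_leftCLM (𝕜 := 𝕜) (E := E) g) (leftCLM_maurerCartan (𝕜 := 𝕜) (E := E) g)
    (differential (F := E) (fun m => J m x) g) (adjoint g⁻¹ x)

/-- On a simply connected group, `ř⁻¹` integrates to a group cocycle. -/
lemma exists_isGroupCocycle_of_simplyConnected [SimplyConnectedSpace G]
    {r : GroupLieAlgebra 𝓘(𝕜, E) G ⊗[𝕜] GroupLieAlgebra 𝓘(𝕜, E) G}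
    (hskew : IsSkew r) (hcybe : SolvesYangBaxter r) (hnondeg : IsNondegenerate r) :
    ∃ B : G → Module.Dual 𝕜 (GroupLieAlgebra 𝓘(𝕜, E) G),
      IsGroupCocycle B ∧ HasDifferentialAtOne B (rCheckInv r hnondeg) := by
  have hcomplete : CompleteSpace E := FiniteDimensional.complete 𝕜 E
  have h3 : LieGroup 𝓘(𝕜, E) (minSmoothness 𝕜 3) G := by
    rw [minSmoothness_of_isRCLikeNormedField]; infer_instance
  have hcocycle := rCheckInv_cocycle hskew hnondeg hcybe
  have hskew' := rCheckInv_skew hskew hnondeg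
  generalize rCheckInv r hnondeg = γ at hcocycle hskew' ⊢
  let γ' : E →ₗ[𝕜] E →ₗ[𝕜] 𝕜 := γ
  let Γ : E →L[𝕜] E →L[𝕜] 𝕜 := LinearMap.toContinuousLinearMap
    ((LinearMap.toContinuousLinearMap : (E →ₗ[𝕜] 𝕜) ≃ₗ[𝕜] _).toLinearMap ∘ₗ γ')
  have hΓ : ∀ x y : E, Γ x y = γ x y := fun x y => rfl
  have hΓskew : ∀ x y : E, Γ x y = -Γ y x := fun x y => by
    rw [hΓ, hΓ]
    exact hskew' x y
  have hΓcocycle : ∀ x y z : E, Γ x (modelBracket 𝕜 G y z) - Γ y (modelBracket 𝕜 G x z) +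
      Γ z (modelBracket 𝕜 G x y) = 0 := fun x y z => by
    rw [hΓ, hΓ, hΓ]
    exact hcocycle x y z
  obtain ⟨B, hB, hone, hd⟩ := exists_modelDeriv_eq (G := G) Γ hΓskew hΓcocycle
  clear_value Γ
  have hd' : ∀ (x : GroupLieAlgebra 𝓘(𝕜, E) G) (g : G) (v : E),
      modelDeriv 𝕜 E 𝕜 (fun m => B m x) g v = γ (maurerCartan 𝕜 E g v) (adjoint g⁻¹ x) :=
    fun x g v => (hd x g v).trans (hΓ _ _)
  exact ⟨B, isGroupCocycle_of_modelDeriv hB hone hd', hasDifferentialAtOne_of_modelDeriv hd'⟩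

/-- The coboundary of `ξ` integrates to the group coboundary `B(g) = Ad*_g ξ - ξ`. -/
lemma exists_isGroupCocycle_of_isLieCoboundary
    {γ : GroupLieAlgebra 𝓘(𝕜, E) G →ₗ[𝕜] Module.Dual 𝕜 (GroupLieAlgebra 𝓘(𝕜, E) G)}
    (hγ : IsLieCoboundary γ) :
    ∃ B : G → Module.Dual 𝕜 (GroupLieAlgebra 𝓘(𝕜, E) G),
      IsGroupCocycle B ∧ HasDifferentialAtOne B γ := by
  have hcomplete : CompleteSpace E := FiniteDimensional.complete 𝕜 E
  obtain ⟨ξ, hξ⟩ := hγ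
  let ξ' : E →L[𝕜] 𝕜 := LinearMap.toContinuousLinearMap (ξ : E →ₗ[𝕜] 𝕜)
  let B : G → Module.Dual 𝕜 (GroupLieAlgebra 𝓘(𝕜, E) G) := fun g =>
    ((ξ'.comp (adjointCLM 𝕜 E g⁻¹) - ξ' : E →L[𝕜] 𝕜) : E →ₗ[𝕜] 𝕜)
  have hBapply : ∀ g x, B g x = ξ (adjoint g⁻¹ x) - ξ x := fun g x => rfl
  have hB : IsSmoothToDual (F := E) B := fun x =>
    (ξ'.contMDiff.comp (contMDiff_adjointCLM_inv_apply (𝕜 := 𝕜) (E := E) (G := G) x)).sub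
      contMDiff_const
  have hd : ∀ (x : GroupLieAlgebra 𝓘(𝕜, E) G) (g : G) (v : E),
      modelDeriv 𝕜 E 𝕜 (fun m => B m x) g v = γ (maurerCartan 𝕜 E g v) (adjoint g⁻¹ x) := by
    intro x g v
    have hA : MDifferentiableAt 𝓘(𝕜, E) 𝓘(𝕜, E) (fun g : G => adjointCLM 𝕜 E g⁻¹ x) g :=
      (contMDiff_adjointCLM_inv_apply (𝕜 := 𝕜) (E := E) (G := G) x).mdifferentiableAt (by simp)
    have h := (modelDeriv_clm_sub_const_apply (E := E) ξ' hA (ξ' x) v).trans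
      (congrArg ξ' (modelDeriv_adjointCLM_inv (𝕜 := 𝕜) (E := E) (G := G) x v g))
    exact (h.trans (map_neg ξ' _)).trans (hξ _ _).symm
  refine ⟨B, ⟨hB, fun g h x => ?_⟩, hasDifferentialAtOne_of_modelDeriv hd⟩
  rw [hBapply, hBapply, hBapply, mul_inv_rev, adjoint_mul]
  abel

/-- Since `ř⁻¹` is skew, the negative of a cocycle integrating `ř⁻¹` is a moment map. -/
lemma isWeaklyHamiltonian_of_isGroupCocycle
    {r : GroupLieAlgebra 𝓘(𝕜, E) G ⊗[𝕜] GroupLieAlgebra 𝓘(𝕜, E) G}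
    (hskew : IsSkew r) (h : IsNondegenerate r)
    {B : G → Module.Dual 𝕜 (GroupLieAlgebra 𝓘(𝕜, E) G)}
    (hB : IsGroupCocycle B) (hd : HasDifferentialAtOne B (rCheckInv r h)) :
    IsWeaklyHamiltonian E G (leftInvariantBivector r) := by
  have hskew' := rCheckInv_skew hskew h
  have hmoment := isMomentMap_iff h (fun g => -B g)
  generalize rCheckInv r h = γ at hd hskew' hmoment
  refine ⟨fun g => -B g, hmoment.2 ⟨fun x => (hB.1 x).neg, fun x g v => ?_⟩⟩
  refine (modelDeriv_neg_apply (E := E) (fun m => B m x) g v).trans ?_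
  refine (congrArg Neg.neg (modelDeriv_of_isGroupCocycle hB hd x g v)).trans ?_
  exact (hskew' _ _).symm

/-- On a connected group, a moment map `J` yields the cocycle `g ↦ J(1) - J(g)`. -/
lemma exists_isGroupCocycle_of_isWeaklyHamiltonian [ConnectedSpace G]
    {r : GroupLieAlgebra 𝓘(𝕜, E) G ⊗[𝕜] GroupLieAlgebra 𝓘(𝕜, E) G}
    (hskew : IsSkew r) (h : IsNondegenerate r)
    (hr : IsWeaklyHamiltonian E G (leftInvariantBivector r)) :
    ∃ B : G → Module.Dual 𝕜 (GroupLieAlgebra 𝓘(𝕜, E) G),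
      IsGroupCocycle B ∧ HasDifferentialAtOne B (rCheckInv r h) := by
  have hskew' := rCheckInv_skew hskew h
  obtain ⟨J, hJ⟩ := hr
  obtain ⟨hsmooth, hJ⟩ := (isMomentMap_iff h J).1 hJ
  generalize rCheckInv r h = γ at hskew' hJ ⊢
  have hB : ∀ (x : GroupLieAlgebra 𝓘(𝕜, E) G) (g : G) (v : E),
      modelDeriv 𝕜 E 𝕜 (fun m => (J 1 - J m) x) g v =
        γ (maurerCartan 𝕜 E g v) (adjoint g⁻¹ x) := by
    intro x g v
    refine (modelDeriv_const_sub_apply (E := E) (J 1 x)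
      (mdifferentiableAt_of_isSmoothToDual hsmooth x g) v).trans ?_
    exact (congrArg Neg.neg (hJ x g v)).trans (hskew' _ _).symm
  exact ⟨fun g => J 1 - J g,
    isGroupCocycle_of_modelDeriv (fun x => contMDiff_const.sub (hsmooth x)) (sub_self _) hB,
    hasDifferentialAtOne_of_modelDeriv hB⟩

end MomentMaps

end TriangularPoisson

open TriangularPoisson in
theorem proposition2p2 {𝕜 : Type*} [RCLike 𝕜]
    {E : Type*} [NormedAddCommGroup E] [NormedSpace 𝕜 E] [FiniteDimensional 𝕜 E]
    {G : Type*} [TopologicalSpace G] [ChartedSpace E G] [Group G] [LieGroup 𝓘(𝕜, E) ∞ G]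
    (r : GroupLieAlgebra 𝓘(𝕜, E) G ⊗[𝕜] GroupLieAlgebra 𝓘(𝕜, E) G)
    (hskew : IsSkew r) (hcybe : SolvesYangBaxter r) (hnondeg : IsNondegenerate r) :
    (ConnectedSpace G →
      (IsWeaklyHamiltonian E G (leftInvariantBivector r) ↔
        ∃ B : G → Module.Dual 𝕜 (GroupLieAlgebra 𝓘(𝕜, E) G),
          IsGroupCocycle B ∧ HasDifferentialAtOne B (rCheckInv r hnondeg))) ∧
    ((∃ B : G → Module.Dual 𝕜 (GroupLieAlgebra 𝓘(𝕜, E) G),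
        IsGroupCocycle B ∧ HasDifferentialAtOne B (rCheckInv r hnondeg)) →
      IsWeaklyHamiltonian E G (leftInvariantBivector r)) ∧
    (SimplyConnectedSpace G ∨ IsLieCoboundary (rCheckInv r hnondeg) →
      IsWeaklyHamiltonian E G (leftInvariantBivector r) ∧
        ∃ B : G → Module.Dual 𝕜 (GroupLieAlgebra 𝓘(𝕜, E) G),
          IsGroupCocycle B ∧ HasDifferentialAtOne B (rCheckInv r hnondeg)) := by
  have h21 : (∃ B : G → Module.Dual 𝕜 (GroupLieAlgebra 𝓘(𝕜, E) G),
      IsGroupCocycle B ∧ HasDifferentialAtOne B (rCheckInv r hnondeg)) →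
      IsWeaklyHamiltonian E G (leftInvariantBivector r) :=
    fun ⟨_, hB, hd⟩ => isWeaklyHamiltonian_of_isGroupCocycle hskew hnondeg hB hd
  refine ⟨fun _ => ⟨exists_isGroupCocycle_of_isWeaklyHamiltonian hskew hnondeg, h21⟩, h21,
    fun h => and_iff_right_of_imp h21 |>.2 ?_⟩
  rcases h with _ | hγ
  · exact exists_isGroupCocycle_of_simplyConnected hskew hcybe hnondeg
  · exact exists_isGroupCocycle_of_isLieCoboundary hγ
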